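/- Let $W=\{W(t,A)\}$, $t\ge 0$, $A\subset\mathbb R$ bounded Borel, be a space-time white noise on a probability space $(\Omega,\mathcal F,\mathbb P)$, i.e. a centered Gaussian process with $\mathbb E[W(t,A)W(t',A')]=(t\wedge t')\,\lambda(A\cap A')$, where $\lambda$ is Lebesgue measure. Let $u$ be a version of the mild solution of the stochastic heat equation $\partial_t u=\tfrac12\Delta u+\partial_t\partial_x W$ on $\mathbb R$, $u(0,\cdot)=0$: for all $t\ge0$, $x\in\mathbb R$, $$u(t,x)=\int_0^t\!\int_{\mathbb R}G(t-s,x-y)\,dW(s,y)\quad\text{a.s. (Wiener integral)},\qquad G(t,x)=\frac{1}{\sqrt{2\pi t}}\,e^{-x^2/(2t)}\mathbf 1_{\{t>0\}}.$$ Let $I=[0,1]$ and let $N(x)=e^{x^2}-1$. Let $L_N$ be the Orlicz space of measurable $f:I\to\mathbb R$ with $\inf_{l>0}\frac1l\bigl[1+\int_I N(l f(t))\,dt\bigr]<\infty$, and put $\|f\|_N=\sup_{1\le p<\infty}\|f\|_{L^p(I)}/\sqrt p$. For $t>0$ let $$\Delta_N(f)(t)=\sup_{1\le p<\infty}\frac1{\sqrt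 p}\,\sup_{|s|\le t}\Bigl(\int_{\{r\in I:\,r+s\in I\}}|f(r+s)-f(r)|^p\,dr\Bigr)^{1/p}.$$ For $0<\alpha<1$ define $$\mathcal B^{\alpha}_N=\Bigl\{f\in L_N:\ \|f\|_N+\sup_{0<t\le1}t^{-\alpha}\Delta_N(f)(t)<\infty\Bigr\},\qquad \mathcal B^{\alpha,0}_N=\bigl\{f\in L_N:\ \Delta_N(f)(t)=o(t^\alpha)\text{ as }t\to0^+\bigr\}.$$ **Theorem.** Let $x\in\mathbb R$ and suppose that $(t,\omega)\mapsto u(t,x,\omega)$ is measurable on $[0,1]\times\Omega$ with respect to the completion of $\lambda\otimes\mathbb P$ (for instance, that $t\mapsto u(t,x)$ is almost surely continuous). Then the sample path $u(\cdot,x):t\in[0,1]\mapsto u(t,x)$ satisfies $$\mathbb P\bigl(u(\cdot,x)\in\mathcal B^{1/4}_N\bigr)=1\qquad\text{and}\qquad\mathbb P\bigl(u(\cdot,x)\in\mathcal B^{1/4,0}_N\bigr)=0 .$$ -/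

import Mathlib

open MeasureTheory ProbabilityTheory Filter Topology
open scoped ENNReal NNReal

namespace StochHeat

noncomputable section

/-- The Young function `N(x) = exp(x²) - 1`. -/
def young (x : ℝ) : ℝ := Real.exp (x ^ 2) - 1

/-- The Orlicz norm `inf_{l > 0} (1/l) (1 + ∫_I N(l f(t)) dt)`, with values in `[0, ∞]`. -/
def orliczNormStar (I : Set ℝ) (f : ℝ → ℝ) : ℝ≥0∞ :=
  ⨅ (l : ℝ) (_ : 0 < l),
    ENNReal.ofReal (1 / l) * (1 + ∫⁻ t in I, ENNReal.ofReal (young (l * f t)))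

/-- The Orlicz space `L_N(I)`; only the values of `f` on `I` matter. -/
def orliczSpace (I : Set ℝ) : Set (ℝ → ℝ) :=
  {f | AEMeasurable f (volume.restrict I) ∧ orliczNormStar I f < ∞}

/-- The equivalent norm `sup_{p ≥ 1} ‖f‖_{L^p(I)} / √p` on `L_N(I)`, with `1 ≤ p < ∞` real. -/
def orliczNorm (I : Set ℝ) (f : ℝ → ℝ) : ℝ≥0∞ :=
  ⨆ (p : ℝ) (_ : 1 ≤ p),
    eLpNorm f (ENNReal.ofReal p) (volume.restrict I) / ENNReal.ofReal (√p)

/-- The `L^p` modulus of continuity: the supremum over `|s| ≤ t` of the `L^p` norm of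
`x ↦ f(x + s) - f(x)` on `I_s = {x ∈ I | x + s ∈ I}`. -/
def lpModulus (p : ℝ) (I : Set ℝ) (f : ℝ → ℝ) (t : ℝ) : ℝ≥0∞ :=
  ⨆ (s : ℝ) (_ : |s| ≤ t),
    eLpNorm (fun x => f (x + s) - f x) (ENNReal.ofReal p)
      (volume.restrict {x | x ∈ I ∧ x + s ∈ I})

/-- The Orlicz modulus of continuity `sup_{p ≥ 1} Δ_p(f, I)(t) / √p`. -/
def orliczModulus (I : Set ℝ) (f : ℝ → ℝ) (t : ℝ) : ℝ≥0∞ :=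
  ⨆ (p : ℝ) (_ : 1 ≤ p), lpModulus p I f t / ENNReal.ofReal (√p)

/-- The Besov-Orlicz norm `‖f‖_N + sup_{0 < t ≤ 1} Δ_N(f, I)(t) / t^α`. -/
def besovOrliczNorm (α : ℝ) (I : Set ℝ) (f : ℝ → ℝ) : ℝ≥0∞ :=
  orliczNorm I f +
    ⨆ (t : ℝ) (_ : 0 < t ∧ t ≤ 1), orliczModulus I f t / ENNReal.ofReal (t ^ α)

/-- The Besov-Orlicz space `B^α_N(I)`. -/
def besovOrlicz (α : ℝ) (I : Set ℝ) : Set (ℝ → ℝ) :=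
  {f | f ∈ orliczSpace I ∧ besovOrliczNorm α I f < ∞}

/-- The subspace `B^{α,0}_N(I)`: the functions of `L_N(I)` with `Δ_N(f, I)(t) = o(t^α)` as
`t → 0+`. -/
def besovOrliczZero (α : ℝ) (I : Set ℝ) : Set (ℝ → ℝ) :=
  {f | f ∈ orliczSpace I ∧
    Tendsto (fun t : ℝ => orliczModulus I f t / ENNReal.ofReal (t ^ α)) (𝓝[>] 0) (𝓝 0)}

/-- The bounded Borel subsets of `ℝ`. -/
abbrev BddBorel : Type := {A : Set ℝ // MeasurableSet A ∧ Bornology.IsBounded A}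

/-- `W` is a space-time white noise under `P`: a centered Gaussian process indexed by times and
bounded Borel sets with covariance `E[W(t,A) W(t',A')] = (t ∧ t') λ(A ∩ A')`. -/
structure IsWhiteNoise {Ω : Type*} [MeasurableSpace Ω] (W : ℝ≥0 → BddBorel → Ω → ℝ)
    (P : Measure Ω) : Prop where
  gaussian : IsGaussianProcess (fun q : ℝ≥0 × BddBorel => W q.1 q.2) P
  centered : ∀ t A, ∫ ω, W t A ω ∂P = 0
  covariance : ∀ t t' A A',
    ∫ ω, W t A ω * W t' A' ω ∂P = (min t t' : ℝ≥0) * volume.real (A.1 ∩ A'.1)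

/-- Lebesgue measure on `(0, ∞) × ℝ`. -/
def spaceTime : Measure (ℝ × ℝ) := (volume.restrict (Set.Ioi 0)).prod volume

/-- Elementary integrands: the finite linear combinations `∑ c(t,A) 1_{(0,t] × A}`. -/
def elementary (c : ℝ≥0 × BddBorel →₀ ℝ) (z : ℝ × ℝ) : ℝ :=
  c.sum fun q a => a * (Set.Ioc 0 (q.1 : ℝ) ×ˢ q.2.1).indicator (fun _ => (1 : ℝ)) z

/-- The integral `∑ c(t,A) W(t,A)` of an elementary integrand. -/
def elementaryIntegral {Ω : Type*} (W : ℝ≥0 → BddBorel → Ω → ℝ) (c : ℝ≥0 × BddBorel →₀ ℝ)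
    (ω : Ω) : ℝ :=
  c.sum fun q a => a * W q.1 q.2 ω

/-- `X` is (a version of) the Wiener integral `∫∫ f(s,y) dW(s,y)` of the square integrable
function `f` on `(0, ∞) × ℝ`: the `L²(P)` limit of the integrals of elementary integrands which
converge to `f` in `L²`. By the isometry property the limit does not depend on the
approximating sequence, up to `P`-null sets. -/
def IsWienerIntegral {Ω : Type*} [MeasurableSpace Ω] (W : ℝ≥0 → BddBorel → Ω → ℝ)
    (P : Measure Ω) (f : ℝ × ℝ → ℝ) (X : Ω → ℝ) : Prop :=
  MemLp f 2 spaceTime ∧ MemLp X 2 P ∧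
    ∃ c : ℕ → (ℝ≥0 × BddBorel →₀ ℝ),
      Tendsto (fun n => eLpNorm (fun z => elementary (c n) z - f z) 2 spaceTime) atTop (𝓝 0) ∧
      Tendsto (fun n => eLpNorm (fun ω => elementaryIntegral W (c n) ω - X ω) 2 P) atTop (𝓝 0)

/-- The Green kernel of the heat equation `∂ₜ u = ½ Δ u` on `ℝ`. -/
def heatKernel (t x : ℝ) : ℝ :=
  if 0 < t then (√(2 * Real.pi * t))⁻¹ * Real.exp (-x ^ 2 / (2 * t)) else 0

/-- `u` is (a version of) the mild solution
`u(t,x) = ∫_0^t ∫_ℝ G(t - s, x - y) dW(s,y)` of the linear stochastic heat equation started at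
zero. The integrand vanishes for `s ≥ t`, so the integral may be taken over `(0, ∞) × ℝ`. -/
def IsMildSolution {Ω : Type*} [MeasurableSpace Ω] (W : ℝ≥0 → BddBorel → Ω → ℝ)
    (P : Measure Ω) (u : ℝ → ℝ → Ω → ℝ) : Prop :=
  ∀ t : ℝ, 0 ≤ t → ∀ x : ℝ,
    IsWienerIntegral W P (fun z => heatKernel (t - z.1) (x - z.2)) (u t x)

end

end StochHeat

namespace StochHeat

/-! ### Wiener integrals -/

section Wiener

variable {Ω : Type*} [MeasurableSpace Ω] {P : Measure Ω} {W : ℝ≥0 → BddBorel → Ω → ℝ}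

/-! Both statements are read off one functional of the path, `expInc h f`, the integral over `r` of
`exp` of one eighth of the squared increment of lag `h` divided by `h ^ (1 / 4)`.

A Wiener integral is centered Gaussian with variance the squared `L²` norm of its integrand
(`IsWienerIntegral.map_eq`). The explicit covariance `mildCov` then shows that the normalized
increments have variance in `[1/6, 1]`, while their covariance at `r ≠ s` is at most `2 √h / √|r -
s|` (`abs_incCov_le`). Hence the mean of `expInc h` is at least `49/48 * (1 - h)` and at most the
finite constant `gaussExp`. The covariance of `exp (X² / 8)` and `exp (Y² / 8)` is bounded by a
multiple of `|Cov (X, Y)|` (`IsWienerIntegral.lintegral_exp_sq_mul_le`), and `|r - s| ^ (-1/2)` is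
integrable, so the variance of `expInc h` is `O(√h)`. This is summable along `h = 2 ^ (-n)`, so
almost surely `expInc` minus its mean tends to `0` along these lags (`ae_tendsto_expInc`).

Membership: `expInc` is then bounded along dyadic lags, which bounds the `L^p` norms of dyadic
increments by a multiple of `√p * h ^ (1 / 4)`; chaining over binary expansions extends this to all
lags (`mem_besovOrlicz_of_expInc_le`).

Non-membership: if the modulus were `o(t ^ (1 / 4))`, the Taylor series of `exp` would force
`expInc` below `(1 - ε²)⁻¹` for all small dyadic lags
(`eventually_expInc_le_of_mem_besovOrliczZero`). For small `ε` this is less than the limiting lower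
bound `49/48`. -/

lemma elementary_add (c d : ℝ≥0 × BddBorel →₀ ℝ) (z : ℝ × ℝ) :
    elementary (c + d) z = elementary c z + elementary d z :=
  Finsupp.sum_add_index' (by simp) (by intros; ring)

lemma elementary_smul (b : ℝ) (c : ℝ≥0 × BddBorel →₀ ℝ) (z : ℝ × ℝ) :
    elementary (b • c) z = b * elementary c z := by
  unfold elementary
  rw [Finsupp.sum_smul_index' (by simp), Finsupp.mul_sum]
  simp only [smul_eq_mul, mul_assoc]

omit [MeasurableSpace Ω] in
lemma elementaryIntegral_add (c d : ℝ≥0 × BddBorel →₀ ℝ) (ω : Ω) :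
    elementaryIntegral W (c + d) ω = elementaryIntegral W c ω + elementaryIntegral W d ω :=
  Finsupp.sum_add_index' (by simp) (by intros; ring)

omit [MeasurableSpace Ω] in
lemma elementaryIntegral_smul (b : ℝ) (c : ℝ≥0 × BddBorel →₀ ℝ) (ω : Ω) :
    elementaryIntegral W (b • c) ω = b * elementaryIntegral W c ω := by
  unfold elementaryIntegral
  rw [Finsupp.sum_smul_index' (by simp), Finsupp.mul_sum]
  simp only [smul_eq_mul, mul_assoc]

lemma measurableSet_box (q : ℝ≥0 × BddBorel) :
    MeasurableSet (Set.Ioc 0 (q.1 : ℝ) ×ˢ q.2.1) :=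
  measurableSet_Ioc.prod q.2.2.1

lemma spaceTime_box (t : ℝ≥0) {A : Set ℝ} :
    spaceTime (Set.Ioc 0 (t : ℝ) ×ˢ A) = t * volume A := by
  rw [spaceTime, Measure.prod_prod, Measure.restrict_apply measurableSet_Ioc,
    Set.inter_eq_left.2 Set.Ioc_subset_Ioi_self, Real.volume_Ioc]
  simp

lemma BddBorel.volume_ne_top (A : BddBorel) : volume A.1 ≠ ∞ := A.2.2.measure_lt_top.ne

lemma memLp_indicator_box (q : ℝ≥0 × BddBorel) (p : ℝ≥0∞) :
    MemLp ((Set.Ioc 0 (q.1 : ℝ) ×ˢ q.2.1).indicator (fun _ => (1 : ℝ))) p spaceTime :=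
  memLp_indicator_const _ (measurableSet_box q) _ <| Or.inr <| by
    rw [spaceTime_box]
    exact ENNReal.mul_ne_top (by simp) q.2.volume_ne_top

lemma memLp_elementary (c : ℝ≥0 × BddBorel →₀ ℝ) (p : ℝ≥0∞) :
    MemLp (elementary c) p spaceTime := by
  have : elementary c = fun z => ∑ q ∈ c.support,
      c q * (Set.Ioc 0 (q.1 : ℝ) ×ˢ q.2.1).indicator (fun _ => (1 : ℝ)) z := rfl
  rw [this]
  exact memLp_finsetSum _ fun q _ => (memLp_indicator_box q p).const_mul _

lemma integral_box_mul_box (q q' : ℝ≥0 × BddBorel) :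
    ∫ z, (Set.Ioc 0 (q.1 : ℝ) ×ˢ q.2.1).indicator (fun _ => (1 : ℝ)) z *
      (Set.Ioc 0 (q'.1 : ℝ) ×ˢ q'.2.1).indicator (fun _ => (1 : ℝ)) z ∂spaceTime =
    (min q.1 q'.1 : ℝ≥0) * volume.real (q.2.1 ∩ q'.2.1) := by
  have h : ∀ z, (Set.Ioc 0 (q.1 : ℝ) ×ˢ q.2.1).indicator (fun _ => (1 : ℝ)) z *
      (Set.Ioc 0 (q'.1 : ℝ) ×ˢ q'.2.1).indicator (fun _ => (1 : ℝ)) z =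
      (Set.Ioc 0 ((min q.1 q'.1 : ℝ≥0) : ℝ) ×ˢ (q.2.1 ∩ q'.2.1)).indicator
        (fun _ => (1 : ℝ)) z := by
    intro z
    rw [← Set.inter_indicator_mul]
    simp only [mul_one, Set.prod_inter_prod, Set.Ioc_inter_Ioc, max_self, NNReal.coe_min]
  simp_rw [h]
  rw [integral_indicator (measurableSet_Ioc.prod (q.2.2.1.inter q'.2.2.1))]
  simp only [integral_const, smul_eq_mul, mul_one, measureReal_restrict_apply_univ]
  rw [measureReal_def, spaceTime_box, ENNReal.toReal_mul, ENNReal.coe_toReal, measureReal_def]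

lemma IsWhiteNoise.memLp (hW : IsWhiteNoise W P) (q : ℝ≥0 × BddBorel) : MemLp (W q.1 q.2) 2 P :=
  (hW.gaussian.hasGaussianLaw_eval q).memLp_two

lemma IsWhiteNoise.hasGaussianLaw_elementaryIntegral (hW : IsWhiteNoise W P)
    (c : ℝ≥0 × BddBorel →₀ ℝ) : HasGaussianLaw (elementaryIntegral W c) P := by
  have h := (hW.gaussian.hasGaussianLaw c.support).map
    (∑ i : c.support, c i • ContinuousLinearMap.proj (R := ℝ) i)
  convert! h using 1
  ext ω
  simp only [elementaryIntegral, Finsupp.sum, Function.comp_apply]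
  rw [← Finset.sum_coe_sort]
  simp

lemma IsWhiteNoise.integral_elementaryIntegral (hW : IsWhiteNoise W P)
    (c : ℝ≥0 × BddBorel →₀ ℝ) : ∫ ω, elementaryIntegral W c ω ∂P = 0 := by
  have := hW.gaussian.isProbabilityMeasure
  simp only [elementaryIntegral, Finsupp.sum]
  rw [integral_finsetSum _ fun q _ =>
    ((hW.memLp q).integrable (by norm_num)).const_mul _]
  simp [integral_const_mul, hW.centered]

/-- The Itô isometry on elementary integrands: both squares expand bilinearly, and the covariance of
`W` is the `L²` inner product of the boxes. -/
lemma IsWhiteNoise.integral_elementaryIntegral_sq (hW : IsWhiteNoise W P)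
    (c : ℝ≥0 × BddBorel →₀ ℝ) :
    ∫ ω, elementaryIntegral W c ω ^ 2 ∂P = ∫ z, elementary c z ^ 2 ∂spaceTime := by
  have h1 : ∀ q q' : ℝ≥0 × BddBorel, Integrable (fun ω => W q.1 q.2 ω * W q'.1 q'.2 ω) P :=
    fun q q' => (hW.memLp q).integrable_mul (hW.memLp q')
  have h2 : ∀ q q' : ℝ≥0 × BddBorel, Integrable (fun z =>
      (Set.Ioc 0 (q.1 : ℝ) ×ˢ q.2.1).indicator (fun _ => (1 : ℝ)) z *
      (Set.Ioc 0 (q'.1 : ℝ) ×ˢ q'.2.1).indicator (fun _ => (1 : ℝ)) z) spaceTime :=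
    fun q q' => (memLp_indicator_box q 2).integrable_mul (memLp_indicator_box q' 2)
  simp only [elementaryIntegral, elementary, Finsupp.sum, sq, Finset.sum_mul_sum]
  have h3 : ∀ q q' x y, c q * x * (c q' * y) = c q * c q' * (x * y) := by intros; ring
  simp_rw [h3]
  rw [integral_finsetSum _ fun q _ => integrable_finsetSum _ fun q' _ => (h1 q q').const_mul _,
    integral_finsetSum _ fun q _ => integrable_finsetSum _ fun q' _ => (h2 q q').const_mul _]
  refine Finset.sum_congr rfl fun q _ => ?_
  rw [integral_finsetSum _ fun q' _ => (h1 q q').const_mul _,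
    integral_finsetSum _ fun q' _ => (h2 q q').const_mul _]
  refine Finset.sum_congr rfl fun q' _ => ?_
  rw [integral_const_mul, integral_const_mul, integral_box_mul_box, hW.covariance]

lemma IsWhiteNoise.map_elementaryIntegral (hW : IsWhiteNoise W P) (c : ℝ≥0 × BddBorel →₀ ℝ) :
    P.map (elementaryIntegral W c) =
      gaussianReal 0 (∫ z, elementary c z ^ 2 ∂spaceTime).toNNReal := by
  have h := hW.hasGaussianLaw_elementaryIntegral c
  rw [h.map_eq_gaussianReal, hW.integral_elementaryIntegral,
    variance_of_integral_eq_zero h.aemeasurable (hW.integral_elementaryIntegral c),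
    hW.integral_elementaryIntegral_sq]

/-- Linearity replaces joint Gaussianity of limits: below, a pair `X`, `Y` enters only through
combinations `z * X + w * Y`, which are again Wiener integrals. -/
lemma IsWienerIntegral.add (hW : IsWhiteNoise W P) {f g : ℝ × ℝ → ℝ} {X Y : Ω → ℝ}
    (hX : IsWienerIntegral W P f X) (hY : IsWienerIntegral W P g Y) :
    IsWienerIntegral W P (fun z => f z + g z) (fun ω => X ω + Y ω) := by
  obtain ⟨hf, hX, c, hc, hc'⟩ := hX
  obtain ⟨hg, hY, d, hd, hd'⟩ := hY
  refine ⟨hf.add hg, hX.add hY, fun n => c n + d n, ?_, ?_⟩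
  · refine tendsto_of_tendsto_of_tendsto_of_le_of_le tendsto_const_nhds
      (by simpa using hc.add hd) (fun _ => zero_le) fun n => ?_
    refine le_trans (le_of_eq ?_) (eLpNorm_add_le ((memLp_elementary (c n) 2).sub hf).1
      ((memLp_elementary (d n) 2).sub hg).1 (by norm_num))
    congr 1
    ext z
    simp [elementary_add]
    ring
  · refine tendsto_of_tendsto_of_tendsto_of_le_of_le tendsto_const_nhds
      (by simpa using hc'.add hd') (fun _ => zero_le) fun n => ?_
    refine le_trans (le_of_eq ?_)
      (eLpNorm_add_le ((hW.hasGaussianLaw_elementaryIntegral (c n)).memLp_two.sub hX).1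
      ((hW.hasGaussianLaw_elementaryIntegral (d n)).memLp_two.sub hY).1 (by norm_num))
    congr 1
    ext z
    simp [elementaryIntegral_add]
    ring

lemma IsWienerIntegral.const_mul {f : ℝ × ℝ → ℝ} {X : Ω → ℝ}
    (hX : IsWienerIntegral W P f X) (b : ℝ) :
    IsWienerIntegral W P (fun z => b * f z) (fun ω => b * X ω) := by
  obtain ⟨hf, hX, c, hc, hc'⟩ := hX
  refine ⟨hf.const_mul b, hX.const_mul b, fun n => b • c n, ?_, ?_⟩
  · have : ∀ n, eLpNorm (fun z => elementary (b • c n) z - b * f z) 2 spaceTime =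
        ‖b‖ₑ * eLpNorm (fun z => elementary (c n) z - f z) 2 spaceTime := fun n => by
      rw [← eLpNorm_const_smul]
      congr 1
      ext z
      simp [elementary_smul]
      ring
    simp_rw [this]
    simpa using ENNReal.Tendsto.const_mul hc (Or.inr enorm_ne_top)
  · have : ∀ n, eLpNorm (fun ω => elementaryIntegral W (b • c n) ω - b * X ω) 2 P =
        ‖b‖ₑ * eLpNorm (fun z => elementaryIntegral W (c n) z - X z) 2 P := fun n => by
      rw [← eLpNorm_const_smul]
      congr 1
      ext z
      simp [elementaryIntegral_smul]
      ring
    simp_rw [this]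
    simpa using ENNReal.Tendsto.const_mul hc' (Or.inr enorm_ne_top)

lemma IsWienerIntegral.congr_ae {f : ℝ × ℝ → ℝ} {X Y : Ω → ℝ}
    (hX : IsWienerIntegral W P f X) (h : X =ᵐ[P] Y) : IsWienerIntegral W P f Y := by
  obtain ⟨hf, hX, c, hc, hc'⟩ := hX
  refine ⟨hf, hX.ae_eq h, c, hc, hc'.congr fun n => eLpNorm_congr_ae ?_⟩
  filter_upwards [h] with ω hω using by rw [hω]

lemma tendsto_integral_sq_of_tendsto_eLpNorm {α : Type*} [MeasurableSpace α] {μ : Measure α}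
    {f : ℕ → α → ℝ} {g : α → ℝ} (hf : ∀ n, MemLp (f n) 2 μ) (hg : MemLp g 2 μ)
    (h : Tendsto (fun n => eLpNorm (fun z => f n z - g z) 2 μ) atTop (𝓝 0)) :
    Tendsto (fun n => ∫ z, f n z ^ 2 ∂μ) atTop (𝓝 (∫ z, g z ^ 2 ∂μ)) := by
  have key : ∀ {k : α → ℝ} (hk : MemLp k 2 μ), ∫ z, k z ^ 2 ∂μ = ‖hk.toLp k‖ ^ 2 := by
    intro k hk
    rw [← real_inner_self_eq_norm_sq, L2.inner_def]
    refine integral_congr_ae ?_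
    filter_upwards [hk.coeFn_toLp] with z hz
    rw [hz]
    simp [sq]
  simp_rw [key (hf _), key hg]
  refine Tendsto.pow ?_ 2
  refine (continuous_norm.tendsto _).comp ?_
  exact (Lp.tendsto_Lp_iff_tendsto_eLpNorm'' _ hf _ hg).2 h

/-- Along an almost surely convergent subsequence the characteristic functions converge by dominated
convergence, and the Gaussian variances converge because the integrands converge in `L²`. -/
theorem IsWienerIntegral.map_eq [IsProbabilityMeasure P] (hW : IsWhiteNoise W P)
    {f : ℝ × ℝ → ℝ} {X : Ω → ℝ} (hX : IsWienerIntegral W P f X) :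
    P.map X = gaussianReal 0 (∫ z, f z ^ 2 ∂spaceTime).toNNReal := by
  obtain ⟨hf, hX, c, hc, hc'⟩ := hX
  have hm : ∀ n, AEMeasurable (elementaryIntegral W (c n)) P := fun n =>
    (hW.hasGaussianLaw_elementaryIntegral (c n)).aemeasurable
  obtain ⟨ns, hns, hlim⟩ := (tendstoInMeasure_of_tendsto_eLpNorm (by norm_num)
    (fun n => (hm n).aestronglyMeasurable) hX.1 hc').exists_seq_tendsto_ae
  have hv := (tendsto_integral_sq_of_tendsto_eLpNorm (fun n => memLp_elementary (c n) 2) hf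
    hc).comp hns.tendsto_atTop
  have : IsProbabilityMeasure (P.map X) := Measure.isProbabilityMeasure_map hX.1.aemeasurable
  refine Measure.ext_of_charFun ?_
  ext t
  have h1 : Tendsto (fun n => charFun (P.map (elementaryIntegral W (c (ns n)))) t) atTop
      (𝓝 (charFun (P.map X) t)) := by
    simp only [charFun_apply_real]
    rw [integral_map hX.1.aemeasurable (by fun_prop)]
    simp_rw [integral_map (hm _) (show AEStronglyMeasurable
      (fun x : ℝ => Complex.exp (t * x * Complex.I)) _ by fun_prop)]
    refine tendsto_integral_of_dominated_convergence (fun _ => 1) (fun n => ?_) (by simp)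
      (fun n => ?_) ?_
    · have := hm (ns n)
      exact AEMeasurable.aestronglyMeasurable (by fun_prop)
    · refine ae_of_all _ fun ω => ?_
      rw [← Complex.ofReal_mul, Complex.norm_exp_ofReal_mul_I]
    · filter_upwards [hlim] with ω hω
      have : Continuous fun y : ℝ => Complex.exp (t * y * Complex.I) := by fun_prop
      exact (this.tendsto _).comp hω
  refine tendsto_nhds_unique h1 ?_
  simp_rw [hW.map_elementaryIntegral, charFun_gaussianReal]
  have hcont : Continuous fun v : ℝ =>
      Complex.exp (t * (0 : ℝ) * Complex.I - (v.toNNReal : ℝ) * t ^ 2 / 2) := by fun_prop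
  exact (hcont.tendsto _).comp hv

end Wiener

/-! ### Covariance of the mild solution -/

lemma heatKernel_of_pos {t : ℝ} (ht : 0 < t) (x : ℝ) :
    heatKernel t x = (√(2 * Real.pi * t))⁻¹ * Real.exp (-x ^ 2 / (2 * t)) := if_pos ht

lemma heatKernel_of_nonpos {t : ℝ} (ht : t ≤ 0) (x : ℝ) : heatKernel t x = 0 := if_neg ht.not_gt

/-- The semigroup property on the diagonal: the value is the heat kernel of time `a + b` at `0`. -/
lemma integral_heatKernel_mul_heatKernel {a b : ℝ} (ha : 0 < a) (hb : 0 < b) (x : ℝ) :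
    ∫ y, heatKernel a (x - y) * heatKernel b (x - y) = (√(2 * Real.pi))⁻¹ * (√(a + b))⁻¹ := by
  rw [integral_sub_left_eq_self (fun y => heatKernel a y * heatKernel b y) volume x]
  have h : ∀ y, heatKernel a y * heatKernel b y =
      ((√(2 * Real.pi * a))⁻¹ * (√(2 * Real.pi * b))⁻¹) *
        Real.exp (-((a + b) / (2 * a * b)) * y ^ 2) := by
    intro y
    rw [heatKernel_of_pos ha, heatKernel_of_pos hb, mul_mul_mul_comm, ← Real.exp_add]
    congr 2
    field_simp
    ring
  simp_rw [h]
  rw [integral_const_mul, integral_gaussian]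
  have hpi := Real.pi_pos
  rw [← Real.sqrt_inv, ← Real.sqrt_inv, ← Real.sqrt_inv, ← Real.sqrt_inv,
    ← Real.sqrt_mul (by positivity), ← Real.sqrt_mul (by positivity),
    ← Real.sqrt_mul (by positivity)]
  congr 1
  field_simp

/-- For `c = 2 * s`, the variance case, the integrand is singular at `r = s`; integrability comes
from its being the nonnegative derivative of a continuous function. -/
lemma integral_inv_sqrt_sub {c s : ℝ} (hs : 0 ≤ s) (hc : 2 * s ≤ c) :
    ∫ r in (0 : ℝ)..s, (√(c - 2 * r))⁻¹ = √c - √(c - 2 * s) := by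
  have hcont : ContinuousOn (fun r : ℝ => -√(c - 2 * r)) (Set.uIcc 0 s) := by fun_prop
  have hd : ∀ r ∈ Set.Ioo (min 0 s) (max 0 s),
      HasDerivAt (fun r : ℝ => -√(c - 2 * r)) ((√(c - 2 * r))⁻¹) r := by
    intro r hr
    rw [min_eq_left hs, max_eq_right hs] at hr
    have h1 : 0 < c - 2 * r := by linarith [hr.2]
    have h2 : HasDerivAt (fun r : ℝ => c - 2 * r) (-2) r := by
      simpa using ((hasDerivAt_id r).const_mul 2).const_sub c
    convert! (h2.sqrt h1.ne').neg using 1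
    field_simp
  have hi := intervalIntegral.intervalIntegrable_deriv_of_nonneg hcont hd
    (fun r _ => by positivity)
  rw [intervalIntegral.integral_eq_sub_of_hasDerivAt_of_le hs
    (by simpa [Set.uIcc_of_le hs] using hcont)
    (fun r hr => hd r (by simpa [min_eq_left hs, max_eq_right hs] using hr)) hi, mul_zero, sub_zero]
  ring

/-- The covariance of the mild solution at two times and a common point. -/
noncomputable def mildCov (t s : ℝ) : ℝ := (√(2 * Real.pi))⁻¹ * (√(t + s) - √|t - s|)

lemma mildCov_comm (t s : ℝ) : mildCov t s = mildCov s t := by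
  rw [mildCov, mildCov, add_comm, abs_sub_comm]

/-- The integrand of the mild solution. -/
noncomputable def mildKernel (x t : ℝ) (z : ℝ × ℝ) : ℝ := heatKernel (t - z.1) (x - z.2)

lemma integral_mildKernel_mul_of_le {x t s : ℝ} (hs : 0 ≤ s) (hst : s ≤ t)
    (ht : MemLp (mildKernel x t) 2 spaceTime) (hs' : MemLp (mildKernel x s) 2 spaceTime) :
    ∫ z, mildKernel x t z * mildKernel x s z ∂spaceTime = mildCov t s := by
  have hint : Integrable (fun z => mildKernel x t z * mildKernel x s z) spaceTime :=
    ht.integrable_mul hs'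
  rw [spaceTime] at hint ⊢
  rw [integral_prod _ hint]
  have h : ∀ r : ℝ, ∫ y, mildKernel x t (r, y) * mildKernel x s (r, y) =
      (Set.Iio s).indicator
        (fun r => (√(2 * Real.pi))⁻¹ * (√(t + s - 2 * r))⁻¹) r := by
    intro r
    by_cases hr : r < s
    · rw [Set.indicator_of_mem (Set.mem_Iio.2 hr)]
      simp only [mildKernel]
      rw [integral_heatKernel_mul_heatKernel (by linarith) (by linarith)]
      congr 3
      ring
    · rw [Set.indicator_of_notMem (by simpa using hr)]
      simp only [mildKernel, heatKernel_of_nonpos (show s - r ≤ 0 by linarith), mul_zero,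
        integral_zero]
  simp_rw [h]
  rw [setIntegral_indicator measurableSet_Iio, Set.Ioi_inter_Iio,
    ← integral_Ioc_eq_integral_Ioo, ← intervalIntegral.integral_of_le hs,
    intervalIntegral.integral_const_mul, integral_inv_sqrt_sub hs (by linarith), mildCov,
    abs_of_nonneg (by linarith)]
  congr 3
  ring

lemma integral_mildKernel_mul {x t s : ℝ} (ht : 0 ≤ t) (hs : 0 ≤ s)
    (hmt : MemLp (mildKernel x t) 2 spaceTime) (hms : MemLp (mildKernel x s) 2 spaceTime) :
    ∫ z, mildKernel x t z * mildKernel x s z ∂spaceTime = mildCov t s := by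
  rcases le_total s t with h | h
  · exact integral_mildKernel_mul_of_le hs h hmt hms
  · rw [mildCov_comm, ← integral_mildKernel_mul_of_le ht h hms hmt]
    simp only [mul_comm]

/-! ### Variance and covariance of the normalized increments. -/

lemma two_le_sqrt_two_pi : 2 ≤ √(2 * Real.pi) :=
  Real.le_sqrt_of_sq_le (by linarith [Real.pi_gt_three])

lemma sqrt_two_pi_le_three : √(2 * Real.pi) ≤ 3 :=
  Real.sqrt_le_iff.2 ⟨by norm_num, by linarith [Real.pi_lt_d2]⟩

/-- The integrand of the increment of the mild solution over `[r, r + h]`, divided by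
`h ^ (1 / 4)`. -/
noncomputable def incKernel (x h r : ℝ) (z : ℝ × ℝ) : ℝ :=
  (√√h)⁻¹ * (mildKernel x (r + h) z + -1 * mildKernel x r z)

/-- The covariance of the normalized increments of the mild solution. -/
noncomputable def incCov (h r s : ℝ) : ℝ :=
  (√h)⁻¹ * (mildCov (r + h) (s + h) - mildCov (r + h) s - mildCov r (s + h) + mildCov r s)

lemma integral_incKernel_mul {x h r s : ℝ} (hh : 0 < h) (hr : 0 ≤ r) (hs : 0 ≤ s)
    (hm : ∀ t, 0 ≤ t → MemLp (mildKernel x t) 2 spaceTime) :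
    ∫ z, incKernel x h r z * incKernel x h s z ∂spaceTime = incCov h r s := by
  have hi : ∀ t t', 0 ≤ t → 0 ≤ t' →
      Integrable (fun z => mildKernel x t z * mildKernel x t' z) spaceTime :=
    fun t t' ht ht' => (hm t ht).integrable_mul (hm t' ht')
  have hrh : 0 ≤ r + h := by linarith
  have hsh : 0 ≤ s + h := by linarith
  have hq : (√√h)⁻¹ * (√√h)⁻¹ = (√h)⁻¹ := by
    rw [← mul_inv, Real.mul_self_sqrt (Real.sqrt_nonneg h)]
  have e : ∀ z, incKernel x h r z * incKernel x h s z =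
      (√h)⁻¹ * (mildKernel x (r + h) z * mildKernel x (s + h) z -
        mildKernel x (r + h) z * mildKernel x s z - mildKernel x r z * mildKernel x (s + h) z +
        mildKernel x r z * mildKernel x s z) := fun z => by
    rw [← hq, incKernel, incKernel]
    ring
  simp_rw [e]
  have h1 : Integrable (fun z => mildKernel x (r + h) z * mildKernel x (s + h) z -
      mildKernel x (r + h) z * mildKernel x s z) spaceTime :=
    (hi _ _ hrh hsh).sub (hi _ _ hrh hs)
  have h2 : Integrable (fun z => mildKernel x (r + h) z * mildKernel x (s + h) z -
      mildKernel x (r + h) z * mildKernel x s z - mildKernel x r z * mildKernel x (s + h) z)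
      spaceTime := h1.sub (hi _ _ hr hsh)
  rw [integral_const_mul, integral_add h2 (hi _ _ hr hs), integral_sub h1 (hi _ _ hr hsh), integral_sub (hi _ _ hrh hsh) (hi _ _ hrh hs),
    integral_mildKernel_mul hrh hsh (hm _ hrh) (hm _ hsh),
    integral_mildKernel_mul hrh hs (hm _ hrh) (hm _ hs),
    integral_mildKernel_mul hr hsh (hm _ hr) (hm _ hsh),
    integral_mildKernel_mul hr hs (hm _ hr) (hm _ hs), incCov]

lemma incCov_self (h r : ℝ) (hh : 0 < h) : incCov h r r =
    (√h)⁻¹ * ((√(2 * Real.pi))⁻¹ *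
      (√(2 * r + 2 * h) + √(2 * r) + 2 * √h - 2 * √(2 * r + h))) := by
  simp only [incCov, mildCov, sub_self, abs_zero, Real.sqrt_zero]
  rw [show r + h + (r + h) = 2 * r + 2 * h by ring, show r + h + r = 2 * r + h by ring,
    show r + (r + h) = 2 * r + h by ring, show r + h - r = h by ring,
    show r - (r + h) = -h by ring, show r + r = 2 * r by ring, abs_neg, abs_of_pos hh]
  ring

/-- Concavity of the square root discards the terms in `r`, leaving `2 / √(2π) ≤ 1`. -/
lemma incCov_self_le_one {h r : ℝ} (hh : 0 < h) (hr : 0 ≤ r) : incCov h r r ≤ 1 := by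
  have h1 : √(2 * r + 2 * h) + √(2 * r) ≤ 2 * √(2 * r + h) := by
    refine abs_le_of_sq_le_sq' ?_ (by positivity) |>.2
    have e1 := Real.sq_sqrt (show 0 ≤ 2 * r + 2 * h by linarith)
    have e2 := Real.sq_sqrt (show 0 ≤ 2 * r by linarith)
    have e3 := Real.sq_sqrt (show 0 ≤ 2 * r + h by linarith)
    nlinarith [sq_nonneg (√(2 * r + 2 * h) - √(2 * r))]
  have hpos : 0 < √h := Real.sqrt_pos.2 hh
  have h2 := two_le_sqrt_two_pi
  rw [incCov_self h r hh, ← mul_assoc, ← mul_inv, inv_mul_le_one₀ (by positivity)]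
  nlinarith

/-- The concavity defect `h1` is at most `√(2h) ≤ 3/2 * √h`, so at least `√h / 2` survives of `2
√h`; dividing by `√(2π) ≤ 3` gives `1/6`. -/
lemma one_sixth_le_incCov_self {h r : ℝ} (hh : 0 < h) (hr : 0 ≤ r) : 1 / 6 ≤ incCov h r r := by
  have h1 : 2 * √(2 * r + h) ≤ √(2 * r + 2 * h) + √(2 * r) + √(2 * h) := by
    refine abs_le_of_sq_le_sq' ?_ (by positivity) |>.2
    have e1 := Real.sq_sqrt (show 0 ≤ 2 * r + 2 * h by linarith)
    have e2 := Real.sq_sqrt (show 0 ≤ 2 * r by linarith)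
    have e3 := Real.sq_sqrt (show 0 ≤ 2 * r + h by linarith)
    have e4 := Real.sq_sqrt (show 0 ≤ 2 * h by linarith)
    have e5 : √(2 * r) ≤ √(2 * r + 2 * h) := Real.sqrt_le_sqrt (by linarith)
    have e6 : √(2 * r) * √(2 * r) ≤ √(2 * r) * √(2 * r + 2 * h) := by gcongr
    nlinarith [Real.sqrt_nonneg (2 * r), Real.sqrt_nonneg (2 * h),
      mul_nonneg (Real.sqrt_nonneg (2 * r + 2 * h)) (Real.sqrt_nonneg (2 * h)),
      mul_nonneg (Real.sqrt_nonneg (2 * r)) (Real.sqrt_nonneg (2 * h))]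
  have h3 : √(2 * h) ≤ 3 / 2 * √h := by
    rw [Real.sqrt_mul (by norm_num)]
    gcongr
    exact Real.sqrt_le_iff.2 (by norm_num)
  have hpos : 0 < √h := Real.sqrt_pos.2 hh
  have h2 := sqrt_two_pi_le_three
  have h4 := two_le_sqrt_two_pi
  rw [incCov_self h r hh, ← mul_assoc, ← mul_inv, le_inv_mul_iff₀ (by positivity)]
  nlinarith

lemma abs_sqrt_abs_sub_sqrt_abs_le {a b : ℝ} (hb : b ≠ 0) :
    |√(|a|) - √(|b|)| ≤ |a - b| / √(|b|) := by
  have hb' : 0 < √(|b|) := Real.sqrt_pos.2 (abs_pos.2 hb)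
  rw [le_div_iff₀ hb']
  have h1 : |√(|a|) - √(|b|)| * (√(|a|) + √(|b|)) = |(|a| - |b|)| := by
    rw [← abs_of_nonneg (show 0 ≤ √(|a|) + √(|b|) by positivity), ← abs_mul]
    congr 1
    have e1 := Real.sq_sqrt (abs_nonneg a)
    have e2 := Real.sq_sqrt (abs_nonneg b)
    nlinarith
  calc |√(|a|) - √(|b|)| * √(|b|) ≤ |√(|a|) - √(|b|)| * (√(|a|) + √(|b|)) := by
        gcongr
        linarith [Real.sqrt_nonneg |a|]
    _ = |(|a| - |b|)| := h1
    _ ≤ |a - b| := abs_abs_sub_abs_le a b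

/-- The covariance is a sum of four first differences of `√|·|` of step `h`, each with a base point
of modulus at least `|r - s|`, hence each at most `h / √|r - s|`. No second-order cancellation is
needed, since this singularity is integrable. -/
lemma abs_incCov_le {h r s : ℝ} (hh : 0 < h) (hr : 0 ≤ r) (hs : 0 ≤ s) (hrs : r ≠ s) :
    |incCov h r s| ≤ 2 * √h * (√|r - s|)⁻¹ := by
  have hd : r - s ≠ 0 := sub_ne_zero.2 hrs
  have hd' : 0 < √|r - s| := Real.sqrt_pos.2 (abs_pos.2 hd)
  have hle : |r - s| ≤ r + s := abs_le.2 ⟨by linarith, by linarith⟩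
  have hp : 0 < r + s := (abs_pos.2 hd).trans_le hle
  have k : ∀ {w w' : ℝ}, |r - s| ≤ w → |w' - w| = h → 0 ≤ w' → |√w' - √w| ≤ h / √|r - s| := by
    intro w w' hw hw' h0
    have hw0 : 0 < w := (abs_pos.2 hd).trans_le hw
    have := abs_sqrt_abs_sub_sqrt_abs_le (a := w') hw0.ne'
    rw [abs_of_nonneg h0, abs_of_pos hw0, hw'] at this
    refine this.trans ?_
    gcongr
  have k1 := k (w := r + s + h) (w' := r + s + 2 * h) (by linarith)
    (by rw [show r + s + 2 * h - (r + s + h) = h by ring, abs_of_pos hh]) (by linarith)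
  have k2 := k (w := r + s) (w' := r + s + h) hle
    (by rw [show r + s + h - (r + s) = h by ring, abs_of_pos hh]) (by linarith)
  have k3 := abs_sqrt_abs_sub_sqrt_abs_le (a := r - s + h) hd
  have k4 := abs_sqrt_abs_sub_sqrt_abs_le (a := r - s - h) hd
  rw [show r - s + h - (r - s) = h by ring, abs_of_pos hh] at k3
  rw [show r - s - h - (r - s) = -h by ring, abs_neg, abs_of_pos hh] at k4
  have hpos : 0 < √h := Real.sqrt_pos.2 hh
  have e : incCov h r s = (√h)⁻¹ * ((√(2 * Real.pi))⁻¹ *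
      ((√(r + s + 2 * h) - √(r + s + h)) - (√(r + s + h) - √(r + s)) +
        (√|r - s + h| - √|r - s|) + (√|r - s - h| - √|r - s|))) := by
    simp only [incCov, mildCov]
    rw [show r + h + (s + h) = r + s + 2 * h by ring, show r + h + s = r + s + h by ring,
      show r + (s + h) = r + s + h by ring, show r + h - (s + h) = r - s by ring,
      show r + h - s = r - s + h by ring, show r - (s + h) = r - s - h by ring]
    ring
  have k5 : |(√(r + s + 2 * h) - √(r + s + h)) - (√(r + s + h) - √(r + s)) +
        (√|r - s + h| - √|r - s|) + (√|r - s - h| - √|r - s|)| ≤ 4 * (h / √|r - s|) := by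
    rw [abs_le] at *
    constructor <;> linarith [k1.1, k1.2, k2.1, k2.2, k3.1, k3.2, k4.1, k4.2]
  have h4 := two_le_sqrt_two_pi
  rw [e, abs_mul, abs_mul, abs_of_pos (inv_pos.2 hpos),
    abs_of_nonneg (inv_nonneg.2 (Real.sqrt_nonneg (2 * Real.pi)))]
  calc _ ≤ (√h)⁻¹ * (2⁻¹ * (4 * (h / √|r - s|))) := by gcongr
    _ = 2 * (h / √h) * (√|r - s|)⁻¹ := by ring
    _ = _ := by rw [Real.div_sqrt]

/-! ### Exponential moments of squares of Gaussian variables -/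

/-- The exponential moment `E[exp(Z² / 4)]` of a standard Gaussian variable `Z`. -/
noncomputable def gaussExp : ℝ≥0∞ := ∫⁻ z, ENNReal.ofReal (Real.exp (z ^ 2 / 4)) ∂gaussianReal 0 1

lemma gaussExp_lt_top : gaussExp < ∞ := by
  rw [gaussExp, gaussianReal_of_var_ne_zero _ one_ne_zero,
    lintegral_withDensity_eq_lintegral_mul _ (measurable_gaussianPDF 0 1) (by fun_prop)]
  have h : ∀ z : ℝ, (gaussianPDF 0 1 * fun z => ENNReal.ofReal (Real.exp (z ^ 2 / 4))) z =
      ENNReal.ofReal ((√(2 * Real.pi))⁻¹ * Real.exp (-(1 / 4) * z ^ 2)) := by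
    intro z
    rw [Pi.mul_apply, gaussianPDF, ← ENNReal.ofReal_mul (gaussianPDFReal_nonneg _ _ _),
      gaussianPDFReal]
    congr 1
    simp only [NNReal.coe_one, mul_one, sub_zero]
    rw [mul_assoc, ← Real.exp_add]
    congr 2
    ring
  simp_rw [h]
  exact ((integrable_exp_neg_mul_sq (by norm_num : (0 : ℝ) < 1 / 4)).const_mul _).lintegral_lt_top

lemma lintegral_exp_mul_of_map_eq {Ω : Type*} [MeasurableSpace Ω] {P : Measure Ω}
    {X : Ω → ℝ} {v : ℝ} (hv : 0 ≤ v) (hX : P.map X = gaussianReal 0 v.toNNReal) (t : ℝ) :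
    ∫⁻ ω, ENNReal.ofReal (Real.exp (t * X ω)) ∂P = ENNReal.ofReal (Real.exp (v * t ^ 2 / 2)) := by
  have hXm : AEMeasurable X P := aemeasurable_of_map_neZero (by rw [hX]; infer_instance)
  have hi : Integrable (fun ω => Real.exp (t * X ω)) P := by
    have := integrable_exp_mul_gaussianReal (μ := 0) (v := v.toNNReal) t
    rw [← hX] at this
    exact (integrable_map_measure (by fun_prop) hXm).1 this
  rw [← ofReal_integral_eq_lintegral_ofReal hi (ae_of_all _ fun ω => (Real.exp_pos _).le)]
  have := mgf_gaussianReal hX t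
  rw [mgf] at this
  rw [this, Real.coe_toNNReal v hv, zero_mul, zero_add]

/-- Linearization by an auxiliary Gaussian variable: exponential moments of squares reduce, by
Tonelli, to moment generating functions of Wiener integrals. -/
lemma ofReal_exp_sq_div_eight (x : ℝ) : ENNReal.ofReal (Real.exp (x ^ 2 / 8)) =
    ∫⁻ z, ENNReal.ofReal (Real.exp (x / 2 * z)) ∂gaussianReal 0 1 := by
  have := lintegral_exp_mul_of_map_eq (P := gaussianReal 0 1) (X := id) (v := 1) zero_le_one
    (by simp) (x / 2)
  simp only [id] at this
  rw [this]
  congr 2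
  ring

/-! ### Exponential moments of one and two Wiener integrals. -/

section

variable {Ω : Type*} [MeasurableSpace Ω] {P : Measure Ω} [IsProbabilityMeasure P]
  {W : ℝ≥0 → BddBorel → Ω → ℝ} {f g : ℝ × ℝ → ℝ} {X Y : Ω → ℝ}

lemma IsWienerIntegral.lintegral_exp_sq (hW : IsWhiteNoise W P) (hX : IsWienerIntegral W P f X) :
    ∫⁻ ω, ENNReal.ofReal (Real.exp (X ω ^ 2 / 8)) ∂P =
    ∫⁻ z, ENNReal.ofReal (Real.exp (z ^ 2 * (∫ y, f y ^ 2 ∂spaceTime) / 8))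
      ∂gaussianReal 0 1 := by
  have hXm : AEMeasurable X P := hX.2.1.1.aemeasurable
  simp_rw [ofReal_exp_sq_div_eight]
  rw [lintegral_lintegral_swap (by fun_prop)]
  refine lintegral_congr fun z => ?_
  have h0 : 0 ≤ ∫ y, f y ^ 2 ∂spaceTime := integral_nonneg fun _ => sq_nonneg _
  rw [show z ^ 2 * (∫ y, f y ^ 2 ∂spaceTime) / 8 =
    (∫ y, f y ^ 2 ∂spaceTime) * (z / 2) ^ 2 / 2 by ring,
    ← lintegral_exp_mul_of_map_eq h0 (hX.map_eq hW)]
  refine lintegral_congr fun ω => ?_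
  congr 2
  ring

lemma integral_lin_comb_sq {α : Type*} [MeasurableSpace α] {μ : Measure α} {f g : α → ℝ}
    (hf : MemLp f 2 μ) (hg : MemLp g 2 μ) (z w : ℝ) :
    ∫ y, (z * f y + w * g y) ^ 2 ∂μ = z ^ 2 * ∫ y, f y ^ 2 ∂μ + 2 * z * w * ∫ y, f y * g y ∂μ +
      w ^ 2 * ∫ y, g y ^ 2 ∂μ := by
  have e : ∀ y, (z * f y + w * g y) ^ 2 =
    z ^ 2 * f y ^ 2 + 2 * z * w * (f y * g y) + w ^ 2 * g y ^ 2 := fun y => by ring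
  simp_rw [e]
  have h1 := hf.integrable_sq.const_mul (z ^ 2)
  have h2 := (hf.integrable_mul hg).const_mul (2 * z * w)
  have h3 := hg.integrable_sq.const_mul (w ^ 2)
  simp only [Pi.mul_apply] at h2
  have h12 : Integrable (fun y => z ^ 2 * f y ^ 2 + 2 * z * w * (f y * g y)) μ := h1.add h2
  rw [integral_add h12 h3, integral_add h1 h2, integral_const_mul, integral_const_mul,
    integral_const_mul]

lemma IsWienerIntegral.lintegral_exp_sq_mul (hW : IsWhiteNoise W P)
    (hX : IsWienerIntegral W P f X) (hY : IsWienerIntegral W P g Y) :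
    ∫⁻ ω, ENNReal.ofReal (Real.exp (X ω ^ 2 / 8)) * ENNReal.ofReal (Real.exp (Y ω ^ 2 / 8)) ∂P =
    ∫⁻ z, ∫⁻ w, ENNReal.ofReal (Real.exp ((z ^ 2 * (∫ y, f y ^ 2 ∂spaceTime) +
      2 * z * w * (∫ y, f y * g y ∂spaceTime) + w ^ 2 * (∫ y, g y ^ 2 ∂spaceTime)) / 8))
      ∂gaussianReal 0 1 ∂gaussianReal 0 1 := by
  have hXm : AEMeasurable X P := hX.2.1.1.aemeasurable
  have hYm : AEMeasurable Y P := hY.2.1.1.aemeasurable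
  have e : ∀ ω, ENNReal.ofReal (Real.exp (X ω ^ 2 / 8)) *
      ENNReal.ofReal (Real.exp (Y ω ^ 2 / 8)) =
      ∫⁻ p, ENNReal.ofReal (Real.exp (1 / 2 * (p.1 * X ω + p.2 * Y ω)))
        ∂((gaussianReal 0 1).prod (gaussianReal 0 1)) := by
    intro ω
    rw [ofReal_exp_sq_div_eight, ofReal_exp_sq_div_eight,
      ← lintegral_prod_mul (by fun_prop) (by fun_prop)]
    refine lintegral_congr fun p => ?_
    rw [← ENNReal.ofReal_mul (Real.exp_pos _).le, ← Real.exp_add]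
    congr 2
    ring
  simp_rw [e]
  rw [lintegral_lintegral_swap (by fun_prop), lintegral_prod _ (by
    refine AEMeasurable.lintegral_prod_right ?_
    fun_prop)]
  refine lintegral_congr fun z => lintegral_congr fun w => ?_
  have hZ := ((hX.const_mul z).add hW (hY.const_mul w)).map_eq hW
  rw [lintegral_exp_mul_of_map_eq (integral_nonneg fun _ => sq_nonneg _) hZ,
    integral_lin_comb_sq hX.1 hY.1]
  congr 2
  ring

/-- Convexity of `exp` between `0` and `|w|`. The error is linear in `|ρ|`, which is what turns
small covariance into small variance. -/
lemma exp_mul_sub_one_le {ρ w : ℝ} (hρ : |ρ| ≤ 1) :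
    Real.exp (ρ * w) ≤ 1 + |ρ| * Real.exp |w| := by
  have h1 : Real.exp (ρ * w) ≤ Real.exp (|ρ| * |w|) :=
    Real.exp_le_exp.2 ((le_abs_self _).trans (abs_mul _ _).le)
  have h2 := convexOn_exp.2 (Set.mem_univ 0) (Set.mem_univ |w|) (sub_nonneg.2 hρ) (abs_nonneg ρ)
    (by ring)
  simp only [smul_eq_mul, mul_zero, zero_add, Real.exp_zero, mul_one] at h2
  linarith [abs_nonneg ρ]

lemma exp_quadratic_le {A B ρ : ℝ} (hA : A ≤ 1) (hB : B ≤ 1) (hρ : |ρ| ≤ 1) (z w : ℝ) :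
    Real.exp ((z ^ 2 * A + 2 * z * w * ρ + w ^ 2 * B) / 8) ≤
      Real.exp (z ^ 2 * A / 8) * Real.exp (w ^ 2 * B / 8) +
        |ρ| * (Real.exp (z ^ 2 / 4) * Real.exp (w ^ 2 / 4)) := by
  have e : Real.exp ((z ^ 2 * A + 2 * z * w * ρ + w ^ 2 * B) / 8) =
      Real.exp (z ^ 2 * A / 8) * Real.exp (w ^ 2 * B / 8) * Real.exp (ρ * (z * w / 4)) := by
    rw [← Real.exp_add, ← Real.exp_add]
    congr 1
    ring
  have h1 : Real.exp (z ^ 2 * A / 8) * Real.exp (w ^ 2 * B / 8) * Real.exp |z * w / 4| ≤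
      Real.exp (z ^ 2 / 4) * Real.exp (w ^ 2 / 4) := by
    rw [← Real.exp_add, ← Real.exp_add, ← Real.exp_add, Real.exp_le_exp]
    -- The cross term costs another `1/8` per variable; the resulting exponent `1/4` is still below
    -- the Gaussian threshold `1/2`.
    have h2 : |z * w / 4| ≤ z ^ 2 / 8 + w ^ 2 / 8 :=
      abs_le.2 ⟨by nlinarith [sq_nonneg (z + w)], by nlinarith [sq_nonneg (z - w)]⟩
    nlinarith [mul_le_mul_of_nonneg_left hA (sq_nonneg z),
      mul_le_mul_of_nonneg_left hB (sq_nonneg w)]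
  calc _ ≤ Real.exp (z ^ 2 * A / 8) * Real.exp (w ^ 2 * B / 8) *
        (1 + |ρ| * Real.exp |z * w / 4|) := by
        rw [e]
        gcongr
        exact exp_mul_sub_one_le hρ
    _ = Real.exp (z ^ 2 * A / 8) * Real.exp (w ^ 2 * B / 8) + |ρ| * (Real.exp (z ^ 2 * A / 8) *
        Real.exp (w ^ 2 * B / 8) * Real.exp |z * w / 4|) := by ring
    _ ≤ _ := by gcongr

lemma IsWienerIntegral.lintegral_exp_sq_mul_le (hW : IsWhiteNoise W P)
    (hX : IsWienerIntegral W P f X) (hY : IsWienerIntegral W P g Y)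
    (hf : ∫ y, f y ^ 2 ∂spaceTime ≤ 1) (hg : ∫ y, g y ^ 2 ∂spaceTime ≤ 1) :
    ∫⁻ ω, ENNReal.ofReal (Real.exp (X ω ^ 2 / 8)) * ENNReal.ofReal (Real.exp (Y ω ^ 2 / 8)) ∂P ≤
    (∫⁻ ω, ENNReal.ofReal (Real.exp (X ω ^ 2 / 8)) ∂P) *
      (∫⁻ ω, ENNReal.ofReal (Real.exp (Y ω ^ 2 / 8)) ∂P) +
      ENNReal.ofReal |∫ y, f y * g y ∂spaceTime| * gaussExp ^ 2 := by
  rw [hX.lintegral_exp_sq_mul hW hY, hX.lintegral_exp_sq hW, hY.lintegral_exp_sq hW]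
  -- Cauchy–Schwarz for unit bounds, by expanding `∫ (f ± g)² ≥ 0`.
  have hρ : |∫ y, f y * g y ∂spaceTime| ≤ 1 := by
    have h1 := integral_lin_comb_sq hX.1 hY.1 1 1
    have h2 := integral_lin_comb_sq hX.1 hY.1 1 (-1)
    have h3 : 0 ≤ ∫ y, (1 * f y + 1 * g y) ^ 2 ∂spaceTime := integral_nonneg fun _ => sq_nonneg _
    have h4 : 0 ≤ ∫ y, (1 * f y + -1 * g y) ^ 2 ∂spaceTime :=
      integral_nonneg fun _ => sq_nonneg _
    rw [abs_le]
    constructor <;> linarith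
  set A := ∫ y, f y ^ 2 ∂spaceTime
  set B := ∫ y, g y ^ 2 ∂spaceTime
  set ρ := ∫ y, f y * g y ∂spaceTime
  rw [gaussExp, sq, ← lintegral_lintegral_mul (by fun_prop) (by fun_prop),
    ← lintegral_lintegral_mul (by fun_prop) (by fun_prop), ← lintegral_const_mul' _ _ (by simp),
    ← lintegral_add_left (by fun_prop)]
  refine lintegral_mono fun z => ?_
  rw [← lintegral_const_mul' _ _ (by simp), ← lintegral_add_left (by fun_prop)]
  refine lintegral_mono fun w => ?_
  rw [← ENNReal.ofReal_mul (by positivity), ← ENNReal.ofReal_mul (by positivity),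
    ← ENNReal.ofReal_mul (by positivity), ← ENNReal.ofReal_add (by positivity) (by positivity)]
  exact ENNReal.ofReal_le_ofReal (exp_quadratic_le hf hg hρ z w)

lemma IsWienerIntegral.lintegral_exp_sq_le (hW : IsWhiteNoise W P)
    (hX : IsWienerIntegral W P f X) (hf : ∫ y, f y ^ 2 ∂spaceTime ≤ 1) :
    ∫⁻ ω, ENNReal.ofReal (Real.exp (X ω ^ 2 / 8)) ∂P ≤ gaussExp := by
  rw [hX.lintegral_exp_sq hW]
  refine lintegral_mono fun z => ENNReal.ofReal_le_ofReal (Real.exp_le_exp.2 ?_)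
  nlinarith [mul_le_mul_of_nonneg_left hf (sq_nonneg z), sq_nonneg z]

/-- From `exp y ≥ 1 + y` and `E[Z²] = 1`. The excess over `1` is what rules out the little-o space.
-/
lemma IsWienerIntegral.le_lintegral_exp_sq (hW : IsWhiteNoise W P)
    (hX : IsWienerIntegral W P f X) :
    ENNReal.ofReal (1 + (∫ y, f y ^ 2 ∂spaceTime) / 8) ≤
      ∫⁻ ω, ENNReal.ofReal (Real.exp (X ω ^ 2 / 8)) ∂P := by
  rw [hX.lintegral_exp_sq hW]
  set A := ∫ y, f y ^ 2 ∂spaceTime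
  have hA : 0 ≤ A := integral_nonneg fun _ => sq_nonneg _
  have h2 : Integrable (fun z : ℝ => z ^ 2) (gaussianReal 0 1) :=
    (memLp_id_gaussianReal (μ := 0) (v := 1) 2).integrable_sq
  have hv : ∫ z, z ^ 2 ∂gaussianReal 0 1 = 1 := by
    have := variance_id_gaussianReal (μ := 0) (v := 1)
    rw [variance_of_integral_eq_zero aemeasurable_id (by simp)] at this
    simpa using this
  have hi : Integrable (fun z : ℝ => 1 + z ^ 2 * A / 8) (gaussianReal 0 1) :=
    (integrable_const _).add ((h2.mul_const A).div_const 8)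
  have : 1 + A / 8 = ∫ z, (1 + z ^ 2 * A / 8) ∂gaussianReal 0 1 := by
    rw [integral_add (integrable_const _) ((h2.mul_const A).div_const 8), integral_div,
      integral_mul_const, hv]
    simp
  rw [this, ofReal_integral_eq_lintegral_ofReal hi (ae_of_all _ fun z => by positivity)]
  refine lintegral_mono fun z => ENNReal.ofReal_le_ofReal ?_
  linarith [Real.add_one_le_exp (z ^ 2 * A / 8)]

end

/-! ### Exponential integrability and growth of `L^p` norms -/

section ExpLp

variable {α : Type*} [MeasurableSpace α] {μ : Measure α} {g : α → ℝ}

/-- The `p`-th power of `t ≤ exp (t² / 2)` at `t = |y| / (2 √p)`; the scale makes the exponent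
independent of `p`. -/
lemma abs_rpow_le_mul_exp {p : ℝ} (hp : 1 ≤ p) (y : ℝ) :
    |y| ^ p ≤ (2 * √p) ^ p * Real.exp (y ^ 2 / 8) := by
  have hp0 : 0 < p := by linarith
  have hsp : 0 < √p := Real.sqrt_pos.2 hp0
  have h1 : |y| ≤ 2 * √p * Real.exp (y ^ 2 / (8 * p)) := by
    have h2 : |y| / (2 * √p) ≤ Real.exp (y ^ 2 / (8 * p)) := by
      have h3 : y ^ 2 / (8 * p) = (|y| / (2 * √p)) ^ 2 / 2 := by
        rw [div_pow, mul_pow, Real.sq_sqrt hp0.le, sq_abs]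
        field_simp
        norm_num
      rw [h3]
      nlinarith [Real.add_one_le_exp ((|y| / (2 * √p)) ^ 2 / 2), sq_nonneg (|y| / (2 * √p) - 1)]
    rwa [div_le_iff₀' (by positivity)] at h2
  calc |y| ^ p ≤ (2 * √p * Real.exp (y ^ 2 / (8 * p))) ^ p := by gcongr
    _ = (2 * √p) ^ p * Real.exp (y ^ 2 / 8) := by
      rw [Real.mul_rpow (by positivity) (by positivity), ← Real.exp_mul]
      congr 2
      field_simp

lemma eLpNorm_ofReal_eq {p : ℝ} (hp : 0 < p) :
    eLpNorm g (ENNReal.ofReal p) μ = (∫⁻ x, ENNReal.ofReal (|g x| ^ p) ∂μ) ^ (1 / p) := by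
  rw [eLpNorm_eq_lintegral_rpow_enorm_toReal (by simpa using hp) (by simp),
    ENNReal.toReal_ofReal hp.le]
  congr 1
  refine lintegral_congr fun x => ?_
  rw [Real.enorm_eq_ofReal_abs, ENNReal.ofReal_rpow_of_nonneg (abs_nonneg _) hp.le]

lemma eLpNorm_le_of_lintegral_exp_le {M : ℝ≥0∞} (hM : 1 ≤ M)
    (h : ∫⁻ x, ENNReal.ofReal (Real.exp (g x ^ 2 / 8)) ∂μ ≤ M) {p : ℝ} (hp : 1 ≤ p) :
    eLpNorm g (ENNReal.ofReal p) μ ≤ 2 * M * ENNReal.ofReal (√p) := by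
  have hp0 : 0 < p := by linarith
  rw [eLpNorm_ofReal_eq hp0]
  calc (∫⁻ x, ENNReal.ofReal (|g x| ^ p) ∂μ) ^ (1 / p)
      ≤ (ENNReal.ofReal (2 * √p) ^ p * M) ^ (1 / p) := by
        gcongr
        calc _ ≤ ∫⁻ x, ENNReal.ofReal (2 * √p) ^ p *
              ENNReal.ofReal (Real.exp (g x ^ 2 / 8)) ∂μ := by
              refine lintegral_mono fun x => ?_
              rw [ENNReal.ofReal_rpow_of_nonneg (by positivity) hp0.le,
                ← ENNReal.ofReal_mul (by positivity)]
              exact ENNReal.ofReal_le_ofReal (abs_rpow_le_mul_exp hp _)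
          _ ≤ _ := by
              rw [lintegral_const_mul' _ _
                (ENNReal.rpow_ne_top_of_nonneg hp0.le ENNReal.ofReal_ne_top)]
              gcongr
    _ = ENNReal.ofReal (2 * √p) * M ^ (1 / p) := by
        rw [ENNReal.mul_rpow_of_nonneg _ _ (by positivity), ← ENNReal.rpow_mul,
          mul_one_div_cancel hp0.ne', ENNReal.rpow_one]
    -- Since `1 ≤ M` and `1 / p ≤ 1`, the bound becomes uniform in `p` apart from `√p`.
    _ ≤ ENNReal.ofReal (2 * √p) * M ^ (1 : ℝ) := by
        gcongr
        exact (div_le_one hp0).2 hp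
    _ = _ := by
        rw [ENNReal.rpow_one, ENNReal.ofReal_mul (by norm_num), ENNReal.ofReal_ofNat]
        ring

lemma pow_div_factorial_mul_le_one (k : ℕ) : ((k : ℝ) / 4) ^ k / k.factorial ≤ 1 := by
  have h1 := Real.pow_div_factorial_le_exp (k : ℝ) (by positivity) k
  have h2 : Real.exp k ≤ 4 ^ k := by
    rw [← Real.exp_one_pow]
    gcongr
    linarith [Real.exp_one_lt_d9]
  rw [div_pow, div_right_comm, div_le_one (by positivity)]
  exact h1.trans h2

/-- The `k`-th Taylor term of `exp` is controlled by the exponent `p = 2 * k` and is at most `ε ^ (2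
* k)`, because `(k / 4) ^ k ≤ k!`. The term `k = 0` uses the mass bound, so the total tends to `1`
as `ε → 0`. -/
lemma lintegral_exp_le_of_eLpNorm_le (hg : AEMeasurable g μ) (hμ : μ Set.univ ≤ 1) {ε : ℝ}
    (hε : 0 ≤ ε) (hε1 : ε < 1)
    (h : ∀ p : ℝ, 1 ≤ p → eLpNorm g (ENNReal.ofReal p) μ ≤ ENNReal.ofReal (ε * √p)) :
    ∫⁻ x, ENNReal.ofReal (Real.exp (g x ^ 2 / 8)) ∂μ ≤ ENNReal.ofReal (1 - ε ^ 2)⁻¹ := by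
  have e : ∀ x, ENNReal.ofReal (Real.exp (g x ^ 2 / 8)) =
      ∑' k : ℕ, ENNReal.ofReal ((g x ^ 2 / 8) ^ k / k.factorial) := by
    intro x
    rw [Real.exp_eq_exp_ℝ, NormedSpace.exp_eq_tsum_div]
    exact ENNReal.ofReal_tsum_of_nonneg (fun k => by positivity)
      (NormedSpace.expSeries_div_summable _)
  simp_rw [e]
  rw [lintegral_tsum (fun k => by fun_prop)]
  have hε2 : ε ^ 2 < 1 := by nlinarith
  rw [← tsum_geometric_of_lt_one (sq_nonneg ε) hε2,
    ENNReal.ofReal_tsum_of_nonneg (fun k => by positivity)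
      (summable_geometric_of_lt_one (sq_nonneg ε) hε2)]
  refine ENNReal.tsum_le_tsum fun k => ?_
  rcases Nat.eq_zero_or_pos k with rfl | hk
  · simpa using hμ
  have hk1 : (1 : ℝ) ≤ k := by exact_mod_cast hk
  have h2k : (0 : ℝ) < 2 * k := by linarith
  have hp := h (2 * k) (by linarith)
  rw [eLpNorm_ofReal_eq h2k, one_div, ENNReal.rpow_inv_le_iff h2k,
    ENNReal.ofReal_rpow_of_nonneg (by positivity) h2k.le] at hp
  have e1 : ∀ x, ENNReal.ofReal ((g x ^ 2 / 8) ^ k / k.factorial) =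
      ENNReal.ofReal ((8 ^ k * k.factorial : ℝ)⁻¹) * ENNReal.ofReal (|g x| ^ (2 * k : ℝ)) := by
    intro x
    rw [← ENNReal.ofReal_mul (by positivity), Real.rpow_mul (abs_nonneg _), Real.rpow_natCast,
      Real.rpow_two, sq_abs, div_pow]
    congr 1
    field_simp
  simp_rw [e1]
  rw [lintegral_const_mul' _ _ ENNReal.ofReal_ne_top]
  refine (mul_le_mul_right hp _).trans ?_
  rw [← ENNReal.ofReal_mul (by positivity)]
  refine ENNReal.ofReal_le_ofReal ?_
  rw [Real.rpow_mul (by positivity), Real.rpow_natCast, Real.rpow_two, mul_pow,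
    Real.sq_sqrt h2k.le, mul_pow]
  have h3 := pow_div_factorial_mul_le_one k
  calc (8 ^ k * (k.factorial : ℝ))⁻¹ * ((ε ^ 2) ^ k * (2 * k) ^ k)
      = (ε ^ 2) ^ k * (((k : ℝ) / 4) ^ k / k.factorial) := by
        rw [div_pow, mul_pow, show (8 : ℝ) = 2 * 4 by norm_num, mul_pow]
        field_simp
    _ ≤ (ε ^ 2) ^ k * 1 := by gcongr
    _ = _ := mul_one _

end ExpLp

/-! ### Shifts -/

lemma shiftSet_eq {s : ℝ} (hs : 0 ≤ s) :
    {x : ℝ | x ∈ Set.Icc (0 : ℝ) 1 ∧ x + s ∈ Set.Icc (0 : ℝ) 1} = Set.Icc 0 (1 - s) := by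
  ext x
  simp only [Set.mem_ofPred_eq, Set.mem_Icc]
  constructor
  · rintro ⟨⟨h1, h2⟩, h3, h4⟩
    exact ⟨h1, by linarith⟩
  · rintro ⟨h1, h2⟩
    exact ⟨⟨h1, by linarith⟩, by linarith, by linarith⟩

lemma eLpNorm_comp_add_right_restrict (g : ℝ → ℝ) (p : ℝ≥0∞) (s : ℝ) {S T : Set ℝ}
    (h : (fun x => x + s) ⁻¹' T = S) :
    eLpNorm (fun x => g (x + s)) p (volume.restrict S) = eLpNorm g p (volume.restrict T) := by
  subst h
  have h1 := (measurePreserving_add_right volume s).restrict_preimage_emb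
    (measurableEmbedding_addRight s) T
  rw [← h1.map_eq, (measurableEmbedding_addRight s).eLpNorm_map_measure]
  rfl

/-- The `L^p` norm of the increments of lag `s ≥ 0` of a function on `[0, 1]`. -/
noncomputable def shiftNorm (f : ℝ → ℝ) (p : ℝ≥0∞) (s : ℝ) : ℝ≥0∞ :=
  eLpNorm (fun x => f (x + s) - f x) p (volume.restrict (Set.Icc 0 (1 - s)))

lemma eLpNorm_shift_eq_shiftNorm_abs (f : ℝ → ℝ) (p : ℝ≥0∞) (s : ℝ) :
    eLpNorm (fun x => f (x + s) - f x) p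
      (volume.restrict {x | x ∈ Set.Icc (0 : ℝ) 1 ∧ x + s ∈ Set.Icc (0 : ℝ) 1}) =
      shiftNorm f p |s| := by
  rcases le_total 0 s with hs | hs
  · rw [shiftSet_eq hs, shiftNorm, abs_of_nonneg hs]
  · rw [shiftNorm, abs_of_nonpos hs, ← shiftSet_eq (neg_nonneg.2 hs),
      ← eLpNorm_comp_add_right_restrict (fun x => f (x + -s) - f x) p s rfl]
    have e : (fun x : ℝ => x + s) ⁻¹'
        {x | x ∈ Set.Icc (0 : ℝ) 1 ∧ x + -s ∈ Set.Icc (0 : ℝ) 1} =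
        {x | x ∈ Set.Icc (0 : ℝ) 1 ∧ x + s ∈ Set.Icc (0 : ℝ) 1} := by
      ext x
      simp [and_comm]
    rw [e, ← eLpNorm_neg]
    congr 1
    ext x
    simp

lemma lpModulus_eq (p : ℝ) (f : ℝ → ℝ) (t : ℝ) :
    lpModulus p (Set.Icc 0 1) f t =
      ⨆ (s : ℝ) (_ : |s| ≤ t), shiftNorm f (ENNReal.ofReal p) |s| := by
  simp only [lpModulus, eLpNorm_shift_eq_shiftNorm_abs]

lemma shiftNorm_zero (f : ℝ → ℝ) (p : ℝ≥0∞) : shiftNorm f p 0 = 0 := by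
  simp [shiftNorm]

lemma eLpNorm_shift_shift_le (f : ℝ → ℝ) (p : ℝ≥0∞) {s t : ℝ} (hs : 0 ≤ s) :
    eLpNorm (fun x => f (x + s + t) - f (x + s)) p (volume.restrict (Set.Icc 0 (1 - (s + t)))) ≤
      shiftNorm f p t := by
  rw [eLpNorm_comp_add_right_restrict (fun y => f (y + t) - f y) p s
    (T := Set.Icc s (1 - t)) (by
      ext x
      simp only [Set.mem_preimage, Set.mem_Icc]
      constructor <;> rintro ⟨h1, h2⟩ <;> constructor <;> linarith)]
  exact eLpNorm_mono_measure _ (Measure.restrict_mono (Set.Icc_subset_Icc_left hs) le_rfl)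

lemma shiftNorm_add_le {f : ℝ → ℝ} (hf : Measurable f) {p : ℝ≥0∞} (hp : 1 ≤ p) {s t : ℝ}
    (hs : 0 ≤ s) (ht : 0 ≤ t) : shiftNorm f p (s + t) ≤ shiftNorm f p s + shiftNorm f p t := by
  have e : (fun x => f (x + (s + t)) - f x) =
      (fun x => f (x + s) - f x) + fun x => f (x + s + t) - f (x + s) := by
    ext x
    simp [add_assoc]
  rw [shiftNorm, e]
  refine (eLpNorm_add_le (by fun_prop) (by fun_prop) hp).trans
    (add_le_add ?_ (eLpNorm_shift_shift_le f p hs))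
  exact eLpNorm_mono_measure _
    (Measure.restrict_mono (Set.Icc_subset_Icc_right (by linarith)) le_rfl)

lemma tendsto_eLpNorm_translate {F : ℝ → ℝ} {p : ℝ≥0∞} (hp : 1 ≤ p) (hp' : p ≠ ∞)
    (hF : MemLp F p volume) (s : ℝ) :
    Tendsto (fun t => eLpNorm (fun r => F (r + t) - F (r + s)) p volume) (𝓝 s) (𝓝 0) := by
  have : Fact (1 ≤ p) := ⟨hp⟩
  have : Fact (p ≠ ∞) := ⟨hp'⟩
  have hmem : ∀ t : ℝ, MemLp (fun r => F (t +ᵥ r)) p volume := fun t =>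
    hF.comp_measurePreserving (measurePreserving_vadd t volume)
  have hc : Continuous fun t : ℝ => DomAddAct.mk t +ᵥ hF.toLp F :=
    (DomAddAct.continuous_mk).vadd continuous_const
  have h1 := hc.tendsto s
  simp only [DomAddAct.mk_vadd_toLp] at h1
  have h2 := (Lp.tendsto_Lp_iff_tendsto_eLpNorm'' _ hmem _ (hmem s)).1 h1
  refine h2.congr fun t => ?_
  congr 1
  ext r
  simp [add_comm]

/-- Continuity of translations in `L^p`, applied to `f` extended by zero. Approximating from below
keeps `x + σ k` in `[0, 1]` whenever `x + s` is. -/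
lemma shiftNorm_le_of_tendsto {f : ℝ → ℝ} (hf : Measurable f) {p : ℝ≥0∞} (hp : 1 ≤ p)
    (hp' : p ≠ ∞) (hfp : MemLp f p (volume.restrict (Set.Icc 0 1))) {s : ℝ} {σ : ℕ → ℝ}
    (h0 : ∀ k, 0 ≤ σ k) (hs : ∀ k, σ k ≤ s) (hlim : Tendsto σ atTop (𝓝 s)) {B : ℝ≥0∞}
    (hB : ∀ k, shiftNorm f p (σ k) ≤ B) : shiftNorm f p s ≤ B := by
  set F := (Set.Icc (0 : ℝ) 1).indicator f with hFdef
  have hF : MemLp F p volume := (memLp_indicator_iff_restrict measurableSet_Icc).2 hfp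
  have hlim' := (tendsto_eLpNorm_translate hp hp' hF s).comp hlim
  have key : ∀ k, shiftNorm f p s ≤
      eLpNorm (fun r => F (r + σ k) - F (r + s)) p volume + B := by
    intro k
    have e : (fun x => f (x + s) - f x) =
      (fun x => f (x + s) - f (x + σ k)) + fun x => f (x + σ k) - f x := by
      ext x
      simp
    rw [shiftNorm, e]
    refine (eLpNorm_add_le (by fun_prop) (by fun_prop) hp).trans (add_le_add ?_ ?_)
    · have e2 : eLpNorm (fun x => f (x + s) - f (x + σ k)) p
          (volume.restrict (Set.Icc 0 (1 - s))) =
          eLpNorm (fun r => F (r + σ k) - F (r + s)) p (volume.restrict (Set.Icc 0 (1 - s))) := by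
        rw [← eLpNorm_neg]
        refine eLpNorm_congr_ae ?_
        filter_upwards [ae_restrict_mem measurableSet_Icc] with x hx
        have h1 : x + s ∈ Set.Icc (0 : ℝ) 1 :=
          ⟨by linarith [hx.1, h0 k, hs k], by linarith [hx.2]⟩
        have h2 : x + σ k ∈ Set.Icc (0 : ℝ) 1 :=
          ⟨by linarith [hx.1, h0 k], by linarith [hx.2, hs k]⟩
        simp [hFdef, Set.indicator_of_mem h1, Set.indicator_of_mem h2]
      rw [e2]
      exact eLpNorm_mono_measure _ Measure.restrict_le_self
    · refine le_trans (eLpNorm_mono_measure _ (Measure.restrict_mono ?_ le_rfl)) (hB k)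
      exact Set.Icc_subset_Icc_right (by linarith [hs k])
  refine ge_of_tendsto' (by simpa using hlim'.add_const B) key

/-! ### Chaining along dyadic shifts -/

/-- The number `2 ^ (-1 / 4)`. -/
noncomputable def dyadicRatio : ℝ := √√(1 / 2)

lemma dyadicRatio_pos : 0 < dyadicRatio := by unfold dyadicRatio; positivity

lemma dyadicRatio_lt_one : dyadicRatio < 1 := by
  rw [dyadicRatio, Real.sqrt_lt' one_pos, one_pow, Real.sqrt_lt' one_pos]
  norm_num

lemma sqrt_sqrt_pow (n : ℕ) : √√((1 / 2 : ℝ) ^ n) = dyadicRatio ^ n := by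
  rw [dyadicRatio, Real.sqrt_eq_iff_mul_self_eq (by positivity) (by positivity), ← mul_pow,
    Real.mul_self_sqrt (by positivity)]
  rw [Real.sqrt_eq_iff_mul_self_eq (by positivity) (by positivity), ← mul_pow,
    Real.mul_self_sqrt (by positivity)]

lemma rpow_one_div_four {h : ℝ} (hh : 0 ≤ h) : h ^ (1 / 4 : ℝ) = √√h := by
  rw [Real.sqrt_eq_rpow, Real.sqrt_eq_rpow, ← Real.rpow_mul hh]
  norm_num

/-- Subadditivity in the lag along the binary expansion of `m`: removing the last bit costs at most
one increment of lag `2 ^ (-(n + k))`. -/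
lemma shiftNorm_dyadic_le {f : ℝ → ℝ} (hf : Measurable f) {p : ℝ≥0∞} (hp : 1 ≤ p) {K : ℝ≥0∞}
    (hK : ∀ n : ℕ, shiftNorm f p ((1 / 2) ^ n) ≤ K * ENNReal.ofReal (dyadicRatio ^ n)) (n k : ℕ) :
    ∀ m : ℕ, m ≤ 2 ^ k → shiftNorm f p (m * (1 / 2) ^ (n + k)) ≤
      K * ENNReal.ofReal (∑ j ∈ Finset.range (k + 1), dyadicRatio ^ (n + j)) := by
  have hq := dyadicRatio_pos
  induction k with
  | zero =>
    intro m hm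
    interval_cases m
    · simp [shiftNorm_zero]
    · simpa using hK n
  | succ k ih =>
    intro m hm
    have hm' : m / 2 ≤ 2 ^ k := by rw [pow_succ] at hm; omega
    rw [Finset.sum_range_succ, ENNReal.ofReal_add (by positivity) (by positivity), mul_add]
    have e1 : ((m / 2 : ℕ) : ℝ) * (1 / 2) ^ (n + k) =
        (2 * (m / 2) : ℕ) * (1 / 2) ^ (n + (k + 1)) := by
      push_cast
      rw [← add_assoc, pow_succ]
      ring
    have ih' := ih _ hm'
    rw [e1] at ih'
    rcases Nat.mod_two_eq_zero_or_one m with h0 | h0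
    · rw [show 2 * (m / 2) = m by omega] at ih'
      exact ih'.trans le_self_add
    · have e2 : (m : ℝ) * (1 / 2) ^ (n + (k + 1)) =
          (2 * (m / 2) : ℕ) * (1 / 2) ^ (n + (k + 1)) + (1 / 2) ^ (n + (k + 1)) := by
        have : m = 2 * (m / 2) + 1 := by omega
        nth_rewrite 1 [this]
        push_cast
        ring
      rw [e2]
      exact (shiftNorm_add_le hf hp (by positivity) (by positivity)).trans
        (add_le_add ih' (hK _))

lemma sum_dyadicRatio_le (n k : ℕ) :
    ∑ j ∈ Finset.range (k + 1), dyadicRatio ^ (n + j) ≤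
      dyadicRatio ^ n * (1 - dyadicRatio)⁻¹ := by
  have hq := dyadicRatio_pos
  simp_rw [pow_add]
  rw [← Finset.mul_sum]
  gcongr
  rw [← tsum_geometric_of_lt_one hq.le dyadicRatio_lt_one]
  exact (summable_geometric_of_lt_one hq.le dyadicRatio_lt_one).sum_le_tsum _
    fun _ _ => by positivity

lemma shiftNorm_le_of_le_pow {f : ℝ → ℝ} (hf : Measurable f) {p : ℝ≥0∞} (hp : 1 ≤ p)
    (hp' : p ≠ ∞) (hfp : MemLp f p (volume.restrict (Set.Icc 0 1))) {K : ℝ≥0∞}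
    (hK : ∀ n : ℕ, shiftNorm f p ((1 / 2) ^ n) ≤ K * ENNReal.ofReal (dyadicRatio ^ n)) {n : ℕ}
    {s : ℝ} (hs : 0 ≤ s) (hsn : s ≤ (1 / 2) ^ n) :
    shiftNorm f p s ≤ K * ENNReal.ofReal (dyadicRatio ^ n * (1 - dyadicRatio)⁻¹) := by
  refine shiftNorm_le_of_tendsto hf hp hp' hfp
    (σ := fun k => (⌊s * 2 ^ (n + k)⌋₊ : ℝ) * (1 / 2) ^ (n + k)) (fun k => by positivity)
    (fun k => ?_) ?_ (fun k => ?_)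
  · have h := Nat.floor_le (show 0 ≤ s * 2 ^ (n + k) by positivity)
    calc _ ≤ s * 2 ^ (n + k) * (1 / 2) ^ (n + k) := by gcongr
      _ = s := by rw [mul_assoc, ← mul_pow]; norm_num
  · refine tendsto_of_tendsto_of_tendsto_of_le_of_le (g := fun k => s - (1 / 2) ^ (n + k))
      (h := fun _ => s) ?_ tendsto_const_nhds (fun k => ?_) (fun k => ?_)
    · have h1 : Tendsto (fun k : ℕ => (1 / 2 : ℝ) ^ (n + k)) atTop (𝓝 0) := by
        have := (tendsto_pow_atTop_nhds_zero_of_lt_one (r := (1 / 2 : ℝ)) (by norm_num)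
          (by norm_num)).comp (tendsto_add_atTop_nat n)
        refine this.congr fun k => ?_
        simp [add_comm]
      simpa using tendsto_const_nhds.sub h1
    · have h := Nat.lt_floor_add_one (s * 2 ^ (n + k))
      have h2 : s * 2 ^ (n + k) * (1 / 2) ^ (n + k) = s := by
        rw [mul_assoc, ← mul_pow]; norm_num
      have h3 : s * 2 ^ (n + k) * (1 / 2) ^ (n + k) ≤
        ((⌊s * 2 ^ (n + k)⌋₊ : ℝ) + 1) * (1 / 2) ^ (n + k) := by gcongr
      simp only
      linarith
    · have h := Nat.floor_le (show 0 ≤ s * 2 ^ (n + k) by positivity)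
      calc _ ≤ s * 2 ^ (n + k) * (1 / 2) ^ (n + k) := by
            gcongr
        _ = s := by rw [mul_assoc, ← mul_pow]; norm_num
  · refine (shiftNorm_dyadic_le hf hp hK n k _ ?_).trans ?_
    · refine Nat.floor_le_of_le ?_
      calc s * 2 ^ (n + k) ≤ (1 / 2) ^ n * 2 ^ (n + k) := by gcongr
        _ = 2 ^ k := by rw [pow_add, ← mul_assoc, ← mul_pow]; norm_num
        _ = _ := by push_cast; rfl
    · gcongr
      exact sum_dyadicRatio_le n k

lemma lpModulus_le {f : ℝ → ℝ} (hf : Measurable f) {p : ℝ} (hp : 1 ≤ p)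
    (hfp : MemLp f (ENNReal.ofReal p) (volume.restrict (Set.Icc 0 1))) {K : ℝ≥0∞}
    (hK : ∀ n : ℕ, shiftNorm f (ENNReal.ofReal p) ((1 / 2) ^ n) ≤
      K * ENNReal.ofReal (dyadicRatio ^ n)) {t : ℝ} (ht : 0 < t) (ht1 : t ≤ 1) :
    lpModulus p (Set.Icc 0 1) f t ≤
      K * ENNReal.ofReal (dyadicRatio⁻¹ * (1 - dyadicRatio)⁻¹) *
        ENNReal.ofReal (t ^ (1 / 4 : ℝ)) := by
  have hq := dyadicRatio_pos
  have hq1 : 0 < 1 - dyadicRatio := sub_pos.2 dyadicRatio_lt_one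
  -- The dyadic scale with `2 ^ (-(n + 1)) < t ≤ 2 ^ (-n)`; passing between its ends costs the
  -- factor `dyadicRatio⁻¹`.
  obtain ⟨n, hn1, hn2⟩ := exists_nat_pow_near_of_lt_one ht ht1
    (show (0 : ℝ) < 1 / 2 by norm_num) (by norm_num)
  rw [lpModulus_eq]
  refine iSup₂_le fun s hs => ?_
  refine (shiftNorm_le_of_le_pow hf (by simpa using hp) (by simp) hfp hK (abs_nonneg s)
    (hs.trans hn2)).trans ?_
  rw [mul_assoc, ← ENNReal.ofReal_mul (by positivity)]
  refine mul_le_mul_right (ENNReal.ofReal_le_ofReal ?_) _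
  rw [rpow_one_div_four ht.le]
  have h1 : dyadicRatio ^ (n + 1) ≤ √√t := by
    rw [← sqrt_sqrt_pow]
    exact Real.sqrt_le_sqrt (Real.sqrt_le_sqrt hn1.le)
  calc dyadicRatio ^ n * (1 - dyadicRatio)⁻¹
      = dyadicRatio⁻¹ * (1 - dyadicRatio)⁻¹ * dyadicRatio ^ (n + 1) := by
        rw [pow_succ]
        field_simp
    _ ≤ _ := by gcongr

/-! ### Besov-Orlicz spaces and exponential moments of increments -/

/-- The exponential functional `∫ exp(|f(r + h) - f(r)|² / (8 √h)) dr` of the increments. -/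
noncomputable def expInc (h : ℝ) (f : ℝ → ℝ) : ℝ≥0∞ :=
  ∫⁻ r in Set.Icc 0 (1 - h),
    ENNReal.ofReal (Real.exp (((√√h)⁻¹ * (f (r + h) + -1 * f r)) ^ 2 / 8))

lemma shiftNorm_eq_mul {h : ℝ} (hh : 0 < h) (f : ℝ → ℝ) (p : ℝ≥0∞) :
    shiftNorm f p h = ENNReal.ofReal (√√h) *
      eLpNorm (fun r => (√√h)⁻¹ * (f (r + h) + -1 * f r)) p
        (volume.restrict (Set.Icc 0 (1 - h))) := by
  have hpos : 0 < √√h := Real.sqrt_pos.2 (Real.sqrt_pos.2 hh)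
  rw [shiftNorm, ← Real.enorm_of_nonneg hpos.le, ← eLpNorm_const_smul]
  congr 1
  ext r
  simp only [Pi.smul_apply, smul_eq_mul]
  rw [mul_inv_cancel_left₀ hpos.ne']
  ring

lemma young_le (y : ℝ) : young ((√8)⁻¹ * y) ≤ Real.exp (y ^ 2 / 8) := by
  rw [young, mul_pow, inv_pow, Real.sq_sqrt (by norm_num), inv_mul_eq_div]
  linarith

lemma mem_orliczSpace_of_lintegral_exp {f : ℝ → ℝ} (hf : Measurable f) {I : Set ℝ}
    (h : ∫⁻ t in I, ENNReal.ofReal (Real.exp (f t ^ 2 / 8)) < ∞) : f ∈ orliczSpace I := by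
  refine ⟨hf.aemeasurable, lt_of_le_of_lt (iInf₂_le (√8)⁻¹ (by positivity)) ?_⟩
  refine ENNReal.mul_lt_top ENNReal.ofReal_lt_top (ENNReal.add_lt_top.2 ⟨by simp, ?_⟩)
  exact lt_of_le_of_lt (lintegral_mono fun t => ENNReal.ofReal_le_ofReal (young_le _)) h

/-- Chaining is done at each fixed `p` with constant `2 * M * √p`; dividing by `√p` leaves a bound
uniform in `p`. -/
theorem mem_besovOrlicz_of_expInc_le {f : ℝ → ℝ} (hf : Measurable f) {M : ℝ≥0∞} (hM : 1 ≤ M)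
    (hM' : M < ∞) (h0 : ∫⁻ t in Set.Icc 0 1, ENNReal.ofReal (Real.exp (f t ^ 2 / 8)) ≤ M)
    (h1 : ∀ n : ℕ, expInc ((1 / 2) ^ n) f ≤ M) : f ∈ besovOrlicz (1 / 4) (Set.Icc 0 1) := by
  refine ⟨mem_orliczSpace_of_lintegral_exp hf (h0.trans_lt hM'), ?_⟩
  have hp0 : ∀ p : ℝ, 1 ≤ p → ENNReal.ofReal (√p) ≠ 0 := fun p hp => by
    simpa using Real.sqrt_pos.2 (by linarith)
  have hLp : ∀ p : ℝ, 1 ≤ p → eLpNorm f (ENNReal.ofReal p) (volume.restrict (Set.Icc 0 1)) ≤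
      2 * M * ENNReal.ofReal (√p) := fun p hp => eLpNorm_le_of_lintegral_exp_le hM h0 hp
  have hM2 : 2 * M < ∞ := ENNReal.mul_lt_top (by simp) hM'
  refine ENNReal.add_lt_top.2 ⟨lt_of_le_of_lt (iSup₂_le fun p hp => ?_) hM2, ?_⟩
  · exact ENNReal.div_le_of_le_mul (hLp p hp)
  set C := ENNReal.ofReal (dyadicRatio⁻¹ * (1 - dyadicRatio)⁻¹)
  have hb : 2 * M * C < ∞ := ENNReal.mul_lt_top hM2 ENNReal.ofReal_lt_top
  refine lt_of_le_of_lt (iSup₂_le fun t ht => ENNReal.div_le_of_le_mul ?_) hb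
  refine iSup₂_le fun p hp => ENNReal.div_le_of_le_mul ?_
  have hK : ∀ n : ℕ, shiftNorm f (ENNReal.ofReal p) ((1 / 2) ^ n) ≤
      2 * M * ENNReal.ofReal (√p) * ENNReal.ofReal (dyadicRatio ^ n) := by
    intro n
    rw [shiftNorm_eq_mul (by positivity), sqrt_sqrt_pow, mul_comm]
    gcongr
    have := eLpNorm_le_of_lintegral_exp_le hM (h1 n) hp
    rwa [sqrt_sqrt_pow] at this
  have hmem : MemLp f (ENNReal.ofReal p) (volume.restrict (Set.Icc 0 1)) :=
    ⟨hf.aestronglyMeasurable, (hLp p hp).trans_lt (ENNReal.mul_lt_top hM2 ENNReal.ofReal_lt_top)⟩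
  refine (lpModulus_le hf hp hmem hK ht.1 ht.2).trans (le_of_eq ?_)
  ring

theorem eventually_expInc_le_of_mem_besovOrliczZero {f : ℝ → ℝ} (hf : Measurable f)
    (h : f ∈ besovOrliczZero (1 / 4) (Set.Icc 0 1)) {ε : ℝ} (hε : 0 < ε) (hε1 : ε < 1) :
    ∀ᶠ n : ℕ in atTop, expInc ((1 / 2) ^ n) f ≤ ENNReal.ofReal (1 - ε ^ 2)⁻¹ := by
  have hlim : Tendsto (fun n : ℕ => (1 / 2 : ℝ) ^ n) atTop (𝓝[>] 0) :=
    tendsto_nhdsWithin_iff.2 ⟨tendsto_pow_atTop_nhds_zero_of_lt_one (by norm_num) (by norm_num),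
      Eventually.of_forall fun n => by simp⟩
  have h1 := (h.2.comp hlim).eventually (gt_mem_nhds
    (ENNReal.ofReal_pos.2 hε))
  filter_upwards [h1] with n hn
  simp only [Function.comp_apply] at hn
  set δ : ℝ := (1 / 2) ^ n
  have hδ : 0 < δ := by positivity
  have hs : 0 < √√δ := by positivity
  rw [rpow_one_div_four hδ.le] at hn
  have h2 : orliczModulus (Set.Icc 0 1) f δ ≤ ENNReal.ofReal ε * ENNReal.ofReal (√√δ) :=
    (ENNReal.div_le_iff (by simpa using hs) (by simp)).1 hn.le
  refine lintegral_exp_le_of_eLpNorm_le (by fun_prop) ?_ hε.le hε1 fun p hp => ?_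
  · simp only [Measure.restrict_apply_univ, Real.volume_Icc]
    exact ENNReal.ofReal_le_one.2 (by linarith)
  · have hp0 : 0 < √p := Real.sqrt_pos.2 (by linarith)
    have h3 : lpModulus p (Set.Icc 0 1) f δ / ENNReal.ofReal (√p) ≤
        ENNReal.ofReal ε * ENNReal.ofReal (√√δ) :=
      le_trans (le_iSup₂ (f := fun (p : ℝ) (_ : 1 ≤ p) =>
        lpModulus p (Set.Icc 0 1) f δ / ENNReal.ofReal (√p)) p hp) h2
    rw [ENNReal.div_le_iff (by simpa using hp0) (by simp), lpModulus_eq] at h3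
    have h4 : shiftNorm f (ENNReal.ofReal p) |δ| ≤ _ :=
      le_trans (le_iSup₂ (f := fun (s : ℝ) (_ : |s| ≤ δ) =>
        shiftNorm f (ENNReal.ofReal p) |s|) δ (abs_of_pos hδ).le) h3
    rw [abs_of_pos hδ, shiftNorm_eq_mul hδ, mul_comm (ENNReal.ofReal ε), mul_assoc,
      ENNReal.mul_le_mul_iff_right (by simpa using hs) (by simp)] at h4
    rwa [ENNReal.ofReal_mul hε.le]

/-! ### Invariance of the spaces under almost everywhere equality. -/

section Congr

variable {f g : ℝ → ℝ} {I : Set ℝ}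

lemma orliczSpace_congr (h : f =ᵐ[volume.restrict I] g) :
    f ∈ orliczSpace I ↔ g ∈ orliczSpace I := by
  have e : orliczNormStar I f = orliczNormStar I g := by
    unfold orliczNormStar
    refine iInf_congr fun l => iInf_congr fun _ => ?_
    congr 2
    refine lintegral_congr_ae ?_
    filter_upwards [h] with t ht
    rw [ht]
  simp only [orliczSpace, Set.mem_ofPred_eq, e]
  rw [aemeasurable_congr h]

lemma lpModulus_congr (hI : MeasurableSet I) (h : f =ᵐ[volume.restrict I] g) (p t : ℝ) :
    lpModulus p I f t = lpModulus p I g t := by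
  refine iSup_congr fun s => iSup_congr fun _ => eLpNorm_congr_ae ?_
  have h1 := (ae_restrict_iff' hI).1 h
  have h2 := (measurePreserving_add_right volume s).quasiMeasurePreserving.ae h1
  have hm : MeasurableSet {x | x ∈ I ∧ x + s ∈ I} := hI.inter (measurable_add_const s hI)
  rw [EventuallyEq, ae_restrict_iff' hm]
  filter_upwards [h1, h2] with x hx hx' hxI
  rw [hx hxI.1, hx' hxI.2]

lemma orliczModulus_congr (hI : MeasurableSet I) (h : f =ᵐ[volume.restrict I] g) (t : ℝ) :
    orliczModulus I f t = orliczModulus I g t := by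
  simp only [orliczModulus, lpModulus_congr hI h]

lemma besovOrlicz_congr (hI : MeasurableSet I) (h : f =ᵐ[volume.restrict I] g) (α : ℝ) :
    f ∈ besovOrlicz α I ↔ g ∈ besovOrlicz α I := by
  have e : besovOrliczNorm α I f = besovOrliczNorm α I g := by
    simp only [besovOrliczNorm, orliczNorm, orliczModulus_congr hI h, eLpNorm_congr_ae h]
  simp only [besovOrlicz, Set.mem_ofPred_eq, e, orliczSpace_congr h]

lemma besovOrliczZero_congr (hI : MeasurableSet I) (h : f =ᵐ[volume.restrict I] g) (α : ℝ) :
    f ∈ besovOrliczZero α I ↔ g ∈ besovOrliczZero α I := by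
  simp only [besovOrliczZero, Set.mem_ofPred_eq, orliczModulus_congr hI h, orliczSpace_congr h]

end Congr

/-! ### Almost sure behaviour of the exponential functionals -/

/-- Summable variances make the series of squared deviations integrable, hence almost surely finite,
so its terms tend to `0`. -/
lemma ae_tendsto_sub_of_lintegral_sq_le {Ω : Type*} [MeasurableSpace Ω] {P : Measure Ω}
    [IsProbabilityMeasure P] {Z : ℕ → Ω → ℝ≥0∞} (hZ : ∀ n, Measurable (Z n)) {e : ℕ → ℝ≥0∞}
    (he : ∑' n, e n ≠ ∞) (hfin : ∀ n, ∫⁻ ω, Z n ω ∂P < ∞)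
    (h : ∀ n, ∫⁻ ω, Z n ω * Z n ω ∂P ≤ (∫⁻ ω, Z n ω ∂P) * (∫⁻ ω, Z n ω ∂P) + e n) :
    ∀ᵐ ω ∂P, (∀ n, Z n ω < ∞) ∧
      Tendsto (fun n => (Z n ω).toReal - (∫⁻ ω, Z n ω ∂P).toReal) atTop (𝓝 0) := by
  have hen : ∀ n, e n ≠ ∞ := ENNReal.ne_top_of_tsum_ne_top he
  have hZt : ∀ n, ∀ᵐ ω ∂P, Z n ω < ∞ := fun n => ae_lt_top (hZ n) (hfin n).ne
  have hsq : ∀ n, ∫⁻ ω, Z n ω * Z n ω ∂P < ∞ := fun n => (h n).trans_lt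
    (ENNReal.add_lt_top.2 ⟨ENNReal.mul_lt_top (hfin n) (hfin n), (hen n).lt_top⟩)
  have hint : ∀ n, ∫ ω, (Z n ω).toReal ∂P = (∫⁻ ω, Z n ω ∂P).toReal := fun n =>
    integral_toReal (hZ n).aemeasurable (hZt n)
  have hint2 : ∀ n, ∫ ω, (Z n ω).toReal ^ 2 ∂P = (∫⁻ ω, Z n ω * Z n ω ∂P).toReal := fun n => by
    have := integral_toReal ((hZ n).mul (hZ n)).aemeasurable (ae_lt_top ((hZ n).mul (hZ n))
      (hsq n).ne)
    simpa [sq] using this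
  have hmem : ∀ n, MemLp (fun ω => (Z n ω).toReal) 2 P := fun n => by
    refine (memLp_two_iff_integrable_sq (hZ n).ennreal_toReal.aestronglyMeasurable).2 ?_
    have := integrable_toReal_of_lintegral_ne_top ((hZ n).mul (hZ n)).aemeasurable (hsq n).ne
    simpa [sq] using this
  have hvar : ∀ n, ∫⁻ ω, ENNReal.ofReal
      (((Z n ω).toReal - (∫⁻ ω, Z n ω ∂P).toReal) ^ 2) ∂P ≤ e n := fun n => by
    have h1 := evariance_eq_lintegral_ofReal (fun ω => (Z n ω).toReal) P
    rw [hint] at h1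
    rw [← h1, ← (hmem n).ofReal_variance_eq, variance_eq_sub (hmem n)]
    simp only [Pi.pow_apply]
    rw [hint, hint2]
    refine ENNReal.ofReal_le_of_le_toReal ?_
    rw [sub_le_iff_le_add', sq, ← ENNReal.toReal_mul, ← ENNReal.toReal_add
      (ENNReal.mul_lt_top (hfin n) (hfin n)).ne (hen n)]
    exact ENNReal.toReal_mono (ENNReal.add_lt_top.2
      ⟨ENNReal.mul_lt_top (hfin n) (hfin n), (hen n).lt_top⟩).ne (h n)
  have hm : ∀ n, Measurable fun ω =>
      ENNReal.ofReal (((Z n ω).toReal - (∫⁻ ω, Z n ω ∂P).toReal) ^ 2) := fun n =>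
    ENNReal.measurable_ofReal.comp (((hZ n).ennreal_toReal.sub_const _).pow_const 2)
  have hsum : ∫⁻ ω, ∑' n, ENNReal.ofReal
      (((Z n ω).toReal - (∫⁻ ω, Z n ω ∂P).toReal) ^ 2) ∂P ≠ ∞ := by
    rw [lintegral_tsum fun n => (hm n).aemeasurable]
    exact ne_top_of_le_ne_top he (ENNReal.tsum_le_tsum hvar)
  filter_upwards [ae_all_iff.2 hZt, ae_lt_top (Measurable.tsum hm) hsum] with ω h1 h2
  refine ⟨h1, ?_⟩
  have h3 := ENNReal.tendsto_atTop_zero_of_tsum_ne_top h2.ne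
  have h4 := (ENNReal.tendsto_toReal ENNReal.zero_ne_top).comp h3
  have h5 := h4.sqrt
  simp only [Function.comp_apply, ENNReal.toReal_zero, Real.sqrt_zero,
    ENNReal.toReal_ofReal (sq_nonneg _), Real.sqrt_sq_eq_abs] at h5
  exact (tendsto_zero_iff_abs_tendsto_zero _).2 h5

/-- The constant `∫_{-1}^1 |u|^{-1/2} du`. -/
noncomputable def singConst : ℝ≥0∞ :=
  ∫⁻ u in Set.Icc (-1 : ℝ) 1, ENNReal.ofReal (√|u|)⁻¹

lemma singConst_lt_top : singConst < ∞ := by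
  have h1 : IntervalIntegrable (fun u : ℝ => (√|u|)⁻¹) volume 0 1 := by
    have := intervalIntegral.intervalIntegrable_rpow' (a := 0) (b := 1)
      (show (-1 : ℝ) < -(1 / 2) by norm_num)
    refine this.congr fun u hu => ?_
    rw [Set.uIoc_of_le zero_le_one] at hu
    rw [abs_of_pos hu.1, Real.sqrt_eq_rpow, Real.rpow_neg hu.1.le]
  have h2 : IntervalIntegrable (fun u : ℝ => (√|u|)⁻¹) volume (-1) 0 := by
    have := (h1.comp_sub_left 0).symm
    simpa using this
  have h3 := (h2.trans h1)
  rw [intervalIntegrable_iff_integrableOn_Icc_of_le (by norm_num)] at h3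
  exact h3.lintegral_lt_top

lemma lintegral_singular_le {r : ℝ} (hr : r ∈ Set.Icc (0 : ℝ) 1) :
    ∫⁻ s in Set.Icc (0 : ℝ) 1, ENNReal.ofReal (√|r - s|)⁻¹ ≤ singConst := by
  rw [singConst, ← lintegral_indicator measurableSet_Icc, ← lintegral_indicator measurableSet_Icc,
    ← lintegral_sub_left_eq_self ((Set.Icc (-1) 1).indicator _) r]
  refine lintegral_mono fun s => ?_
  by_cases hs : s ∈ Set.Icc (0 : ℝ) 1
  · have : r - s ∈ Set.Icc (-1 : ℝ) 1 :=
      ⟨by linarith [hr.1, hs.2], by linarith [hr.2, hs.1]⟩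
    simp [Set.indicator_of_mem hs, Set.indicator_of_mem this]
  · simp [Set.indicator_of_notMem hs]

lemma lintegral_incCov_le {h : ℝ} (hh : 0 < h) :
    ∫⁻ r in Set.Icc 0 (1 - h), ∫⁻ s in Set.Icc 0 (1 - h), ENNReal.ofReal |incCov h r s| ≤
      ENNReal.ofReal (2 * √h) * singConst := by
  have hsub : Set.Icc 0 (1 - h) ⊆ Set.Icc (0 : ℝ) 1 := Set.Icc_subset_Icc_right (by linarith)
  calc _ ≤ ∫⁻ _ in Set.Icc 0 (1 - h), ENNReal.ofReal (2 * √h) * singConst := by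
        refine setLIntegral_mono' measurableSet_Icc fun r hr => ?_
        calc _ ≤ ∫⁻ s in Set.Icc 0 (1 - h), ENNReal.ofReal (2 * √h) *
              ENNReal.ofReal (√|r - s|)⁻¹ := by
              refine lintegral_mono_ae ?_
              filter_upwards [ae_restrict_mem measurableSet_Icc,
                ae_restrict_of_ae (Measure.ae_ne volume r)] with s hs hsr
              rw [← ENNReal.ofReal_mul (by positivity)]
              exact ENNReal.ofReal_le_ofReal (abs_incCov_le hh hr.1 hs.1 hsr.symm)
          _ = ENNReal.ofReal (2 * √h) *
              ∫⁻ s in Set.Icc 0 (1 - h), ENNReal.ofReal (√|r - s|)⁻¹ :=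
              lintegral_const_mul' _ _ ENNReal.ofReal_ne_top
          _ ≤ _ := by
              gcongr
              exact (lintegral_mono_set hsub).trans (lintegral_singular_le (hsub hr))
    _ ≤ _ := by
        rw [setLIntegral_const, Real.volume_Icc]
        refine mul_le_of_le_one_right' (ENNReal.ofReal_le_one.2 ?_)
        linarith

lemma lintegral_mul_self_lintegral {α Ω : Type*} [MeasurableSpace α] [MeasurableSpace Ω]
    {μ : Measure α} [SFinite μ] {P : Measure Ω} [SFinite P] {Y : α → Ω → ℝ≥0∞}
    (hY : Measurable (Function.uncurry Y)) :
    ∫⁻ ω, (∫⁻ r, Y r ω ∂μ) * (∫⁻ r, Y r ω ∂μ) ∂P =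
      ∫⁻ z, (∫⁻ ω, Y z.1 ω * Y z.2 ω ∂P) ∂μ.prod μ := by
  have h1 : ∀ ω, AEMeasurable (fun r => Y r ω) μ := fun ω =>
    (hY.comp measurable_prodMk_right).aemeasurable
  have h2 : Measurable fun q : Ω × α × α => Y q.2.1 q.1 * Y q.2.2 q.1 :=
    (hY.comp (show Measurable fun q : Ω × α × α => (q.2.1, q.1) by fun_prop)).mul
      (hY.comp (show Measurable fun q : Ω × α × α => (q.2.2, q.1) by fun_prop))
  simp_rw [← fun ω => lintegral_prod_mul (h1 ω) (h1 ω)]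
  rw [lintegral_lintegral_swap h2.aemeasurable]

/-! ### Exponential functionals of a jointly measurable path. -/

section Path

variable {Ω : Type*} [MeasurableSpace Ω] {P : Measure Ω} [IsProbabilityMeasure P]
  {W : ℝ≥0 → BddBorel → Ω → ℝ} {x : ℝ} {v : ℝ × Ω → ℝ}

lemma measurable_expInc (hv : Measurable v) (h : ℝ) :
    Measurable fun ω => expInc h (fun t => v (t, ω)) := by
  unfold expInc
  refine Measurable.lintegral_prod_left' (f := fun z : ℝ × Ω => ENNReal.ofReal
    (Real.exp (((√√h)⁻¹ * (v (z.1 + h, z.2) + -1 * v (z.1, z.2))) ^ 2 / 8))) ?_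
  fun_prop

lemma lintegral_expInc (hv : Measurable v) (h : ℝ) :
    ∫⁻ ω, expInc h (fun t => v (t, ω)) ∂P = ∫⁻ r in Set.Icc 0 (1 - h), ∫⁻ ω,
      ENNReal.ofReal (Real.exp (((√√h)⁻¹ * (v (r + h, ω) + -1 * v (r, ω))) ^ 2 / 8)) ∂P := by
  unfold expInc
  rw [lintegral_lintegral_swap (by fun_prop)]

omit [IsProbabilityMeasure P] in
lemma ae_isWienerIntegral_increment (hW : IsWhiteNoise W P)
    (hWI : ∀ᵐ t ∂volume.restrict (Set.Icc (0 : ℝ) 1),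
      IsWienerIntegral W P (mildKernel x t) fun ω => v (t, ω)) {h : ℝ} (hh : 0 < h) :
    ∀ᵐ r ∂volume.restrict (Set.Icc (0 : ℝ) (1 - h)), IsWienerIntegral W P (incKernel x h r)
      fun ω => (√√h)⁻¹ * (v (r + h, ω) + -1 * v (r, ω)) := by
  rw [ae_restrict_iff' measurableSet_Icc] at hWI ⊢
  have h2 := (measurePreserving_add_right volume h).quasiMeasurePreserving.ae hWI
  filter_upwards [hWI, h2] with r h1 h2 hr
  have h1 := h1 ⟨hr.1, by linarith [hr.2]⟩
  have h2 := h2 ⟨by linarith [hr.1], by linarith [hr.2]⟩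
  exact (h2.add hW (h1.const_mul (-1))).const_mul _

variable (hW : IsWhiteNoise W P) (hv : Measurable v)
  (hmild : ∀ t, 0 ≤ t → MemLp (mildKernel x t) 2 spaceTime)
  (hWI : ∀ᵐ t ∂volume.restrict (Set.Icc (0 : ℝ) 1),
    IsWienerIntegral W P (mildKernel x t) fun ω => v (t, ω))

include hW hv hmild hWI

lemma lintegral_lintegral_exp_path_le :
    ∫⁻ ω, (∫⁻ t in Set.Icc (0 : ℝ) 1, ENNReal.ofReal (Real.exp (v (t, ω) ^ 2 / 8))) ∂P ≤
      gaussExp := by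
  rw [lintegral_lintegral_swap (by fun_prop)]
  calc _ ≤ ∫⁻ _ in Set.Icc (0 : ℝ) 1, gaussExp := by
        refine lintegral_mono_ae ?_
        filter_upwards [hWI, ae_restrict_mem measurableSet_Icc] with t ht htI
        refine ht.lintegral_exp_sq_le hW ?_
        simp only [sq]
        rw [integral_mildKernel_mul htI.1 htI.1 (hmild t htI.1) (hmild t htI.1), mildCov]
        have h1 : √(t + t) ≤ 2 := Real.sqrt_le_iff.2 ⟨by norm_num, by linarith [htI.2]⟩
        simp only [sub_self, abs_zero, Real.sqrt_zero, sub_zero]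
        have h2 := two_le_sqrt_two_pi
        rw [inv_mul_le_one₀ (by linarith)]
        linarith
    _ = gaussExp := by simp

lemma lintegral_expInc_le {h : ℝ} (hh : 0 < h) :
    ∫⁻ ω, expInc h (fun t => v (t, ω)) ∂P ≤ gaussExp := by
  rw [lintegral_expInc hv]
  calc _ ≤ ∫⁻ _ in Set.Icc (0 : ℝ) (1 - h), gaussExp := by
        refine lintegral_mono_ae ?_
        filter_upwards [ae_isWienerIntegral_increment hW hWI hh,
          ae_restrict_mem measurableSet_Icc] with r hr hrI
        refine hr.lintegral_exp_sq_le hW ?_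
        simp only [sq]
        rw [integral_incKernel_mul hh hrI.1 hrI.1 hmild]
        exact incCov_self_le_one hh hrI.1
    _ ≤ _ := by
        rw [setLIntegral_const, Real.volume_Icc]
        refine mul_le_of_le_one_right' (ENNReal.ofReal_le_one.2 ?_)
        linarith

lemma le_lintegral_expInc {h : ℝ} (hh : 0 < h) :
    -- `49/48 = 1 + (1/6) / 8`, from the variance lower bound `1/6`.
    ENNReal.ofReal (49 / 48 * (1 - h)) ≤ ∫⁻ ω, expInc h (fun t => v (t, ω)) ∂P := by
  rw [lintegral_expInc hv]
  calc ENNReal.ofReal (49 / 48 * (1 - h))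
      = ∫⁻ _ in Set.Icc (0 : ℝ) (1 - h), ENNReal.ofReal (49 / 48) := by
        rw [setLIntegral_const, Real.volume_Icc, sub_zero, ENNReal.ofReal_mul (by norm_num)]
    _ ≤ _ := by
        refine lintegral_mono_ae ?_
        filter_upwards [ae_isWienerIntegral_increment hW hWI hh,
          ae_restrict_mem measurableSet_Icc] with r hr hrI
        refine le_trans (ENNReal.ofReal_le_ofReal ?_) (hr.le_lintegral_exp_sq hW)
        simp only [sq]
        rw [integral_incKernel_mul hh hrI.1 hrI.1 hmild]
        linarith [one_sixth_le_incCov_self hh hrI.1]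

/-- The square is a double integral over `(r, s)`; decoupling bounds each second moment by the
product of means plus `|incCov h r s| * gaussExp ^ 2`, and the last term integrates to `O(√h)`. -/
lemma lintegral_expInc_sq_le {h : ℝ} (hh : 0 < h) :
    ∫⁻ ω, expInc h (fun t => v (t, ω)) * expInc h (fun t => v (t, ω)) ∂P ≤
      (∫⁻ ω, expInc h (fun t => v (t, ω)) ∂P) * (∫⁻ ω, expInc h (fun t => v (t, ω)) ∂P) +
        ENNReal.ofReal (2 * √h) * singConst * gaussExp ^ 2 := by
  set Y : ℝ → Ω → ℝ≥0∞ := fun r ω =>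
    ENNReal.ofReal (Real.exp (((√√h)⁻¹ * (v (r + h, ω) + -1 * v (r, ω))) ^ 2 / 8)) with hY
  have hYm : Measurable (Function.uncurry Y) := by
    simp only [hY, Function.uncurry_def]
    fun_prop
  have hEm : Measurable fun r => ∫⁻ ω, Y r ω ∂P := hYm.lintegral_prod_right'
  set μ := volume.restrict (Set.Icc (0 : ℝ) (1 - h))
  have e : ∀ ω, expInc h (fun t => v (t, ω)) = ∫⁻ r, Y r ω ∂μ := fun _ => rfl
  have hρm : Measurable fun z : ℝ × ℝ => ENNReal.ofReal |incCov h z.1 z.2| := by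
    simp only [incCov, mildCov]
    fun_prop
  rw [lintegral_expInc hv]
  simp_rw [e]
  rw [lintegral_mul_self_lintegral hYm]
  have hae := ae_isWienerIntegral_increment hW hWI hh
  calc _ ≤ ∫⁻ z, (∫⁻ ω, Y z.1 ω ∂P) * (∫⁻ ω, Y z.2 ω ∂P) +
        ENNReal.ofReal |incCov h z.1 z.2| * gaussExp ^ 2 ∂μ.prod μ := by
        refine lintegral_mono_ae ?_
        have hae' : ∀ᵐ r ∂μ, IsWienerIntegral W P (incKernel x h r)
            (fun ω => (√√h)⁻¹ * (v (r + h, ω) + -1 * v (r, ω))) ∧ 0 ≤ r := by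
          filter_upwards [hae, ae_restrict_mem measurableSet_Icc] with r h1 h2 using ⟨h1, h2.1⟩
        filter_upwards [Measure.quasiMeasurePreserving_fst.ae hae',
          Measure.quasiMeasurePreserving_snd.ae hae'] with z h1 h2
        have := h1.1.lintegral_exp_sq_mul_le hW h2.1
          (by simp only [sq]
              rw [integral_incKernel_mul hh h1.2 h1.2 hmild]
              exact incCov_self_le_one hh h1.2)
          (by simp only [sq]
              rw [integral_incKernel_mul hh h2.2 h2.2 hmild]
              exact incCov_self_le_one hh h2.2)
        rwa [integral_incKernel_mul hh h1.2 h2.2 hmild] at this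
    _ = (∫⁻ r, ∫⁻ ω, Y r ω ∂P ∂μ) * (∫⁻ r, ∫⁻ ω, Y r ω ∂P ∂μ) +
        (∫⁻ z, ENNReal.ofReal |incCov h z.1 z.2| ∂μ.prod μ) * gaussExp ^ 2 := by
        rw [lintegral_add_right _ (hρm.mul_const _), lintegral_mul_const _ hρm,
          lintegral_prod_mul hEm.aemeasurable hEm.aemeasurable]
    _ ≤ _ := by
        gcongr
        rw [lintegral_prod _ hρm.aemeasurable]
        exact lintegral_incCov_le hh

theorem ae_tendsto_expInc :
    ∀ᵐ ω ∂P, (∀ n : ℕ, expInc ((1 / 2) ^ n) (fun t => v (t, ω)) < ∞) ∧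
      Tendsto (fun n : ℕ => (expInc ((1 / 2) ^ n) (fun t => v (t, ω))).toReal -
        (∫⁻ ω, expInc ((1 / 2) ^ n) (fun t => v (t, ω)) ∂P).toReal) atTop (𝓝 0) := by
  refine ae_tendsto_sub_of_lintegral_sq_le (Z := fun (n : ℕ) ω =>
    expInc ((1 / 2) ^ n) (fun t => v (t, ω))) (fun n => measurable_expInc hv _)
    (e := fun n : ℕ => ENNReal.ofReal (2 * √((1 / 2) ^ n)) * singConst * gaussExp ^ 2) ?_
    (fun n => (lintegral_expInc_le hW hv hmild hWI (by positivity)).trans_lt gaussExp_lt_top)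
    (fun n => lintegral_expInc_sq_le hW hv hmild hWI (by positivity))
  rw [ENNReal.tsum_mul_right, ENNReal.tsum_mul_right]
  refine ENNReal.mul_ne_top (ENNReal.mul_ne_top ?_ singConst_lt_top.ne)
    (ENNReal.pow_ne_top gaussExp_lt_top.ne)
  have hsq : ∀ n : ℕ, √((1 / 2 : ℝ) ^ n) = √(1 / 2) ^ n := fun n => by
    rw [Real.sqrt_eq_iff_mul_self_eq (by positivity) (by positivity), ← mul_pow,
      Real.mul_self_sqrt (by positivity)]
  have hlt : √(1 / 2 : ℝ) < 1 := by
    rw [Real.sqrt_lt' one_pos]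
    norm_num
  have hsum : Summable fun n : ℕ => 2 * √((1 / 2 : ℝ) ^ n) := by
    simp_rw [hsq]
    exact (summable_geometric_of_lt_one (by positivity) hlt).mul_left 2
  rw [← ENNReal.ofReal_tsum_of_nonneg (fun n => by positivity) hsum]
  exact ENNReal.ofReal_ne_top

theorem ae_mem_besovOrlicz :
    ∀ᵐ ω ∂P, (fun t => v (t, ω)) ∈ besovOrlicz (1 / 4) (Set.Icc 0 1) := by
  have hm : Measurable fun ω => ∫⁻ t in Set.Icc (0 : ℝ) 1,
      ENNReal.ofReal (Real.exp (v (t, ω) ^ 2 / 8)) :=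
    Measurable.lintegral_prod_left'
      (f := fun z : ℝ × Ω => ENNReal.ofReal (Real.exp (v z ^ 2 / 8))) (by fun_prop)
  filter_upwards [ae_tendsto_expInc hW hv hmild hWI, ae_lt_top hm
    ((lintegral_lintegral_exp_path_le hW hv hmild hWI).trans_lt gaussExp_lt_top).ne]
    with ω ⟨h1, h2⟩ h3
  -- A convergent sequence is bounded; adding the uniform bound `gaussExp` on the means bounds
  -- `expInc` itself along dyadic lags.
  obtain ⟨b, hb⟩ := h2.bddAbove_range
  set A := ∫⁻ t in Set.Icc (0 : ℝ) 1, ENNReal.ofReal (Real.exp (v (t, ω) ^ 2 / 8))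
  refine mem_besovOrlicz_of_expInc_le (M := 1 + A + (ENNReal.ofReal b + gaussExp))
    (by fun_prop) (le_add_right le_self_add) ?_ (le_add_right le_add_self) fun n => ?_
  · exact ENNReal.add_lt_top.2 ⟨ENNReal.add_lt_top.2 ⟨ENNReal.one_lt_top, h3⟩,
      ENNReal.add_lt_top.2 ⟨ENNReal.ofReal_lt_top, gaussExp_lt_top⟩⟩
  · refine le_trans ?_ le_add_self
    have h4 := hb ⟨n, rfl⟩
    have h5 := lintegral_expInc_le hW hv hmild hWI (h := (1 / 2) ^ n) (by positivity)
    have h6 := ENNReal.toReal_mono gaussExp_lt_top.ne h5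
    rw [← ENNReal.ofReal_toReal (h1 n).ne]
    refine (ENNReal.ofReal_le_ofReal (q := b + gaussExp.toReal) ?_).trans ?_
    · simp only at h4
      linarith
    · refine ENNReal.ofReal_add_le.trans ?_
      rw [ENNReal.ofReal_toReal gaussExp_lt_top.ne]

theorem ae_notMem_besovOrliczZero :
    ∀ᵐ ω ∂P, (fun t => v (t, ω)) ∉ besovOrliczZero (1 / 4) (Set.Icc 0 1) := by
  filter_upwards [ae_tendsto_expInc hW hv hmild hWI] with ω ⟨h1, h2⟩ hmem
  -- With `ε = 1/10` the upper bound is `100/99`, strictly below the limit `49/48` of the lower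
  -- bounds on the means.
  have h3 := eventually_expInc_le_of_mem_besovOrliczZero (by fun_prop) hmem
    (show (0 : ℝ) < 1 / 10 by norm_num) (by norm_num)
  have h4 : Tendsto (fun n : ℕ => (100 / 99 : ℝ) - 49 / 48 * (1 - (1 / 2) ^ n)) atTop
      (𝓝 (100 / 99 - 49 / 48 * (1 - 0))) :=
    ((tendsto_pow_atTop_nhds_zero_of_lt_one (by norm_num) (by norm_num)).const_sub 1
      |>.const_mul _).const_sub _
  have h5 := le_of_tendsto_of_tendsto h2 h4 (by
    filter_upwards [h3] with n hn
    have h6 := le_lintegral_expInc hW hv hmild hWI (h := (1 / 2) ^ n) (by positivity)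
    have h7 := lintegral_expInc_le hW hv hmild hWI (h := (1 / 2) ^ n) (by positivity)
    have h8 := (ENNReal.ofReal_le_iff_le_toReal (h7.trans_lt gaussExp_lt_top).ne).1 h6
    have h9 := ENNReal.toReal_mono ENNReal.ofReal_ne_top hn
    rw [ENNReal.toReal_ofReal (by norm_num)] at h9
    norm_num at h9 h8 ⊢
    linarith)
  norm_num at h5

end Path

end StochHeat

/-! ### Reduction to a jointly measurable version. -/

theorem theorem2p2 {Ω : Type*} [MeasurableSpace Ω] (P : Measure Ω) [IsProbabilityMeasure P]
    (W : ℝ≥0 → StochHeat.BddBorel → Ω → ℝ) (hW : StochHeat.IsWhiteNoise W P)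
    (u : ℝ → ℝ → Ω → ℝ) (hu : StochHeat.IsMildSolution W P u) (x : ℝ)
    (hmeas : AEMeasurable (fun z : ℝ × Ω => u z.1 x z.2)
      ((volume.restrict (Set.Icc (0 : ℝ) 1)).prod P)) :
    (∀ᵐ ω ∂P, (fun t => u t x ω) ∈ StochHeat.besovOrlicz (1 / 4) (Set.Icc 0 1)) ∧
    (∀ᵐ ω ∂P, (fun t => u t x ω) ∉ StochHeat.besovOrliczZero (1 / 4) (Set.Icc 0 1)) := by
  -- By Fubini, `v` agrees with `u` almost surely for almost every time, which preserves the Wiener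
  -- integral property, and almost everywhere in time for almost every `ω`, which preserves
  -- membership in both spaces.
  obtain ⟨v, hv, huv⟩ := hmeas
  have hmild : ∀ t, 0 ≤ t → MemLp (StochHeat.mildKernel x t) 2 StochHeat.spaceTime :=
    fun t ht => (hu t ht x).1
  have hWI : ∀ᵐ t ∂volume.restrict (Set.Icc (0 : ℝ) 1),
      StochHeat.IsWienerIntegral W P (StochHeat.mildKernel x t) fun ω => v (t, ω) := by
    filter_upwards [Measure.ae_ae_of_ae_prod huv, ae_restrict_mem measurableSet_Icc] with t ht htI
    exact (hu t htI.1 x).congr_ae ht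
  have hpath : ∀ᵐ ω ∂P, (fun t => u t x ω) =ᵐ[volume.restrict (Set.Icc (0 : ℝ) 1)]
      fun t => v (t, ω) :=
    Measure.ae_ae_of_ae_prod (Measure.measurePreserving_swap.quasiMeasurePreserving.ae huv)
  constructor
  · filter_upwards [hpath, StochHeat.ae_mem_besovOrlicz hW hv hmild hWI] with ω h1 h2
    exact (StochHeat.besovOrlicz_congr measurableSet_Icc h1 _).2 h2
  · filter_upwards [hpath, StochHeat.ae_notMem_besovOrliczZero hW hv hmild hWI] with ω h1 h2
    rwa [StochHeat.besovOrliczZero_congr measurableSet_Icc h1]
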